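/- Let $A\in GL(3,\mathbb Z)$ be hyperbolic (no eigenvalue of modulus $1$), and suppose that all eigenvalues of $A$ are real, positive, simple and irrational, and that exactly one of them is greater than $1$. Let $f_A:\mathbb T^3\to\mathbb T^3$, $\mathbb T^3=\mathbb R^3/\mathbb Z^3$, be the automorphism induced by $A$. For $\varepsilon>0$ put $W^s_\varepsilon(x)=\{y: d(f_A^n x,f_A^n y)<\varepsilon\ \forall n\ge 0\}$ and $W^u_\varepsilon(x)=\{y: d(f_A^{-n} x,f_A^{-n} y)<\varepsilon\ \forall n\ge 0\}$. A compact set $\Delta$ with $f_A(\Delta)=\Delta$ has local product structure if there are $\varepsilon,\delta>0$ such that for all $x,y\in\Delta$ with $d(x,y)<\delta$ the set $W^s_\varepsilon(x)\cap W^u_\varepsilon(y)$ is a single point, which belongs to $\Delta$. It is locally maximal if $\Delta=\bigcap_{n\in\mathbb Z}f_A^n(V)$ for some neighbourhood $V$ of $\Delta$. A hyperbolic set of $f_A$ is a compact set $\Lambda$ with $f_A(\Lambda)=\Lambda$ over which the tangent bundle has a $Df_A$-invariant splitting $E^s\oplus E^u$ with $\|Df_A^n v\|\le C\lambda^n\|v\|$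 for $v\in E^s$ and $\|Df_A^{-n}v\|\le C\lambda^n\|v\|$ for $v\in E^u$, for all $n\ge0$ and some constants $C>0$, $\lambda\in(0,1)$. (a) If $\Lambda\subseteq\mathbb T^3$ is compact, connected, satisfies $f_A(\Lambda)=\Lambda$, has more than one point and contains a fixed point of $f_A$, then every compact set $\Delta\supseteq\Lambda$ with $f_A(\Delta)=\Delta$ and with local product structure is equal to $\mathbb T^3$. (b) There is a continuous curve $\gamma:[0,1]\to\mathbb T^3$ through a fixed point of $f_A$ such that the orbit closure $\Lambda=\overline{\bigcup_{n\in\mathbb Z}f_A^n(\gamma([0,1]))}$ is a compact, connected set with more than one point, $f_A(\Lambda)=\Lambda$, $\Lambda\neq\mathbb T^3$, $\Lambda$ is a hyperbolic set of $f_A$, and: - among the compact sets $\Delta\supseteq\Lambda$ with $f_A(\Delta)=\Delta$, the only one with local product structure is $\mathbb T^3$; - among the hyperbolic sets $\Delta\supseteq\Lambda$ of $f_A$, the only locally maximal one is $\mathbb T^3$; - $\Lambda$ is not locally premaximal: it is not true that for every open $U\supseteq\Lambda$ there is a hyperbolic set $\Delta$ with local product structure and $\Lambda\subseteq\Delta\subseteq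 U$; - the Katok–Hasselblatt question has a negative answer for $\Lambda$: there is an open set $V\supseteq\Lambda$ such that no locally maximal hyperbolic set $\Delta$ satisfies $\Lambda\subseteq\Delta\subseteq V$. -/

import Mathlib

open Set Filter Topology

noncomputable section

/-- The torus `𝕋³ = ℝ³ / ℤ³`. -/
abbrev T3 : Type := UnitAddTorus (Fin 3)

/-- Euclidean space `ℝ³`, the tangent space of `𝕋³` at each of its points. -/
abbrev E3 : Type := EuclideanSpace ℝ (Fin 3)

/-- The universal covering `ℝ³ → 𝕋³`. -/
def torusProj (v : E3) : T3 := fun i => ((v i : ℝ) : UnitAddCircle)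

/-! ### Toral automorphisms -/

/-- The endomorphism of `𝕋³` induced by an integer matrix. -/
def toralMap (M : Matrix (Fin 3) (Fin 3) ℤ) (x : T3) : T3 := fun i => ∑ j, M i j • x j

theorem toralMap_continuous (M : Matrix (Fin 3) (Fin 3) ℤ) : Continuous (toralMap M) := by
  unfold toralMap
  fun_prop

theorem toralMap_mul (M N : Matrix (Fin 3) (Fin 3) ℤ) (x : T3) :
    toralMap (M * N) x = toralMap M (toralMap N x) := by
  funext i
  simp only [toralMap, Matrix.mul_apply, Finset.sum_smul, Finset.smul_sum, mul_smul]
  exact Finset.sum_comm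

theorem toralMap_one (x : T3) : toralMap 1 x = x := by
  funext i
  simp [toralMap, Matrix.one_apply, ite_smul]

/-- The automorphism `f_A` of `𝕋³` induced by `A ∈ GL(3, ℤ)`. -/
def toralAut (A : GL (Fin 3) ℤ) : T3 ≃ₜ T3 where
  toFun := toralMap (A : Matrix (Fin 3) (Fin 3) ℤ)
  invFun := toralMap ((A⁻¹ : GL (Fin 3) ℤ) : Matrix (Fin 3) (Fin 3) ℤ)
  left_inv x := by
    rw [← toralMap_mul, ← Units.val_mul, inv_mul_cancel, Units.val_one, toralMap_one]
  right_inv x := by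
    rw [← toralMap_mul, ← Units.val_mul, mul_inv_cancel, Units.val_one, toralMap_one]
  continuous_toFun := toralMap_continuous _
  continuous_invFun := toralMap_continuous _

/-- The complex number `z` is an eigenvalue of the integer matrix `A`. -/
def IsEigenvalue (A : GL (Fin 3) ℤ) (z : ℂ) : Prop :=
  ((A : Matrix (Fin 3) (Fin 3) ℤ).map (Int.cast : ℤ → ℂ)).charpoly.IsRoot z

/-- `A` is hyperbolic: it has no eigenvalue on the unit circle. -/
def IsHyperbolicMatrix (A : GL (Fin 3) ℤ) : Prop :=
  ∀ z : ℂ, IsEigenvalue A z → ‖z‖ ≠ 1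

/-- All the eigenvalues of `A` are simple. -/
def HasSimpleEigenvalues (A : GL (Fin 3) ℤ) : Prop :=
  ((A : Matrix (Fin 3) (Fin 3) ℤ).map (Int.cast : ℤ → ℂ)).charpoly.roots.Nodup

/-! ### Invariant sets of homeomorphisms of a metric space -/

/-- The closure of the full orbit `⋃ n ∈ ℤ, fⁿ(S)` of a set `S`. -/
def orbitClosure {X : Type*} [MetricSpace X] (f : X ≃ₜ X) (S : Set X) : Set X :=
  closure (⋃ n : ℤ, (f ^ n) '' S)

/-- The local stable set `W^s_ε(x)`. -/
def localStable {X : Type*} [MetricSpace X] (f : X ≃ₜ X) (ε : ℝ) (x : X) : Set X :=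
  {y | ∀ n : ℕ, dist ((f ^ (n : ℤ)) x) ((f ^ (n : ℤ)) y) < ε}

/-- The local unstable set `W^u_ε(x)`. -/
def localUnstable {X : Type*} [MetricSpace X] (f : X ≃ₜ X) (ε : ℝ) (x : X) : Set X :=
  {y | ∀ n : ℕ, dist ((f ^ (-(n : ℤ))) x) ((f ^ (-(n : ℤ))) y) < ε}

/-- Local product structure of a (compact, invariant, hyperbolic) set `Δ`: for suitable
`ε, δ > 0`, whenever `x, y ∈ Δ` are `δ`-close, `W^s_ε(x)` and `W^u_ε(y)` meet in exactly one
point, and that point belongs to `Δ`. On a hyperbolic set, `ε` may always be decreased (at the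
expense of `δ`), because `W^s_ε(x)` and `W^u_ε(y)` meet as soon as `x, y` are close enough. -/
def HasLocalProductStructure {X : Type*} [MetricSpace X] (f : X ≃ₜ X) (Δ : Set X) : Prop :=
  ∃ ε > 0, ∃ δ > 0, ∀ x ∈ Δ, ∀ y ∈ Δ, dist x y < δ →
    ∃ z ∈ Δ, localStable f ε x ∩ localUnstable f ε y = {z}

/-- `Δ` is the maximal invariant set in some neighbourhood of itself. -/
def IsLocallyMaximal {X : Type*} [MetricSpace X] (f : X ≃ₜ X) (Δ : Set X) : Prop :=
  ∃ V ∈ 𝓝ˢ Δ, Δ = ⋂ n : ℤ, (f ^ n) '' V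

/-! ### Hyperbolic sets in `𝕋³` -/

/-- The map `g : 𝕋³ → 𝕋³` is differentiable at `x` with derivative `L`, in the charts of `𝕋³`
given by the covering `ℝ³ → 𝕋³`, which identify all the tangent spaces with `ℝ³`. -/
def HasTorusFDerivAt (g : T3 → T3) (L : E3 →L[ℝ] E3) (x : T3) : Prop :=
  ∃ G : E3 → E3, G 0 = 0 ∧ HasFDerivAt G L 0 ∧
    ∀ᶠ v in 𝓝 (0 : E3), g (x + torusProj v) = g x + torusProj (G v)

/-- `Λ` is a hyperbolic set of `f`: it is compact and invariant, and the tangent bundle over it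
has an invariant splitting into a uniformly contracted and a uniformly expanded subbundle.
Here `D n x` is the derivative of `fⁿ` at `x`. -/
def IsHyperbolicSet (f : T3 ≃ₜ T3) (Λ : Set T3) : Prop :=
  IsCompact Λ ∧ f '' Λ = Λ ∧
  ∃ D : ℤ → T3 → (E3 →L[ℝ] E3),
    (∀ n : ℤ, ∀ x ∈ Λ, HasTorusFDerivAt (f ^ n : T3 ≃ₜ T3) (D n x) x) ∧
    ∃ Es Eu : T3 → Submodule ℝ E3,
      (∀ x ∈ Λ, IsCompl (Es x) (Eu x) ∧
        (Es x).map (D 1 x : E3 →ₗ[ℝ] E3) = Es (f x) ∧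
        (Eu x).map (D 1 x : E3 →ₗ[ℝ] E3) = Eu (f x)) ∧
      ∃ C > (0 : ℝ), ∃ l ∈ Ioo (0 : ℝ) 1, ∀ x ∈ Λ, ∀ n : ℕ,
        (∀ v ∈ Es x, ‖D n x v‖ ≤ C * l ^ n * ‖v‖) ∧
        (∀ v ∈ Eu x, ‖D (-(n : ℤ)) x v‖ ≤ C * l ^ n * ‖v‖)

/-- `Λ` is locally premaximal: every neighbourhood of `Λ` contains a hyperbolic set with local
product structure that contains `Λ`. -/
def IsLocallyPremaximal (f : T3 ≃ₜ T3) (Λ : Set T3) : Prop :=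
  ∀ U : Set T3, IsOpen U → Λ ⊆ U →
    ∃ Δ : Set T3, IsHyperbolicSet f Δ ∧ HasLocalProductStructure f Δ ∧ Λ ⊆ Δ ∧ Δ ⊆ U

end

/-! In real eigencoordinates on the universal cover, `f_A` becomes `diag(a, b, c)` with `a < b < 1 <
c`. The characteristic polynomial is an irreducible cubic, so a nonzero period has three nonzero
coordinates, and the unstable line is dense in the torus.

For (a), lift `Λ ⊆ Δ` about the fixed point to closed invariant sets `L ⊆ S`. Local product
structure makes `S` closed under the bracket `(w.1, v.2)` of nearby points, and connectedness of `Λ`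
gives a point `y ≠ 0` reached from `0` by arbitrarily fine bounded chains in `L`. If some finely
reached point has nonzero unstable coordinate, forward iteration flattens the chains onto the
unstable axis, and bracketing puts a segment, hence a half-axis, into `S` (`unstable_segment_mem`,
`unstable_ray_mem_of_segment`). Otherwise the finely reached points lie in the stable plane, and
bracketing along chains carries unstable displacements from `0` to `y` and back
(`mem_iff_of_finelyReach`). Backward iterates of `y` recur modulo nonzero periods `m`, so the trace
of `S` on the unstable axis is invariant under the translations by `m.2`, which are nonzero and
arbitrarily small; this trace is the whole axis (`unstable_line_mem`). Recurrence extends a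
half-line to a line (`unstable_line_mem_of_ray`), and density finishes.

For (b), it is enough to find a nonconstant curve through `0` whose orbit avoids a ball. A graph `x
↦ (x, φ x)` in the stable plane works: forward iterates stay near `0`, and backward iterates are
expansions that `exists_avoiding_graph` keeps away from the relevant lifts of the forbidden point,
by a convergent sequence of perturbations. By (a), only the whole torus can then contain `Λ` and
have local product structure. A locally maximal set inherits that structure from the torus. -/

/-! ### Eigenvalues and eigencoordinates of the integer matrix. -/

/-- A rational `3 × 3` matrix without rational eigenvalues acts cyclically: no nonzero real left
eigenvector is orthogonal to a nonzero rational vector. -/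
theorem left_eigenvector_eq_zero_of_orthogonal {B : Matrix (Fin 3) (Fin 3) ℚ}
    (hB : ∀ x : ℚ, ¬ B.charpoly.IsRoot x) {k : Fin 3 → ℚ} (hk : k ≠ 0) {w : Fin 3 → ℝ} {r : ℝ}
    (hw : Matrix.vecMul w (B.map (Rat.cast : ℚ → ℝ)) = r • w)
    (hwk : w ⬝ᵥ (fun i => (k i : ℝ)) = 0) : w = 0 := by
  classical
  have hdeg : B.charpoly.natDegree = 3 := by simp
  have hirr : Irreducible B.charpoly :=
    Polynomial.irreducible_of_degree_le_three_of_not_isRoot (by simp) hB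
  set K : Matrix (Fin 3) (Fin 3) ℚ := Matrix.of fun i j => ((B ^ (j : ℕ)).mulVec k) i with hK
  -- The columns of `K` are `k, Bk, B²k`. A linear relation among them is `p(B)k = 0` with `deg p <
  -- 3`; as `p` is coprime to the irreducible characteristic polynomial, Bézout and Cayley–Hamilton
  -- force `k = 0`.
  have hdet : K.det ≠ 0 := by
    intro h0
    obtain ⟨x, hx0, hx⟩ := Matrix.exists_mulVec_eq_zero_iff.2 h0
    set p : Polynomial ℚ := ∑ j : Fin 3, Polynomial.C (x j) * Polynomial.X ^ (j : ℕ) with hp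
    have hpk : (Polynomial.aeval B p).mulVec k = 0 := by
      rw [← hx, hp]
      ext i
      simp only [map_sum, map_mul, Polynomial.aeval_C, map_pow, Polynomial.aeval_X]
      simp only [Fin.sum_univ_three, Algebra.algebraMap_eq_smul_one,
        smul_mul_assoc, one_mul, Matrix.add_apply, Matrix.smul_apply, smul_eq_mul,
        hK, Matrix.mulVec, dotProduct, Matrix.of_apply]
      ring
    have hpc : ∀ j : Fin 3, p.coeff j = x j := by
      intro j
      fin_cases j <;> simp [hp, Fin.sum_univ_three, Polynomial.coeff_X, Polynomial.coeff_C]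
    have hp0 : p ≠ 0 := by
      intro h
      apply hx0
      ext j
      rw [← hpc j, h]
      simp
    have hpd : p.natDegree < 3 := by
      rw [hp]
      refine lt_of_le_of_lt (Polynomial.natDegree_sum_le_of_forall_le (n := 2) _ _ ?_)
        (by norm_num)
      intro j _
      refine (Polynomial.natDegree_C_mul_X_pow_le _ _).trans ?_
      have := j.2
      omega
    have hcop : IsCoprime B.charpoly p := by
      rw [hirr.coprime_iff_not_dvd]
      intro hd
      have := Polynomial.natDegree_le_of_dvd hd hp0
      omega
    obtain ⟨s, t, hst⟩ := hcop
    apply hk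
    have h1 := congrArg (fun q : Polynomial ℚ => (Polynomial.aeval B q).mulVec k) hst
    simp only [map_add, map_mul, Matrix.aeval_self_charpoly, mul_zero, zero_add, map_one,
      Matrix.one_mulVec] at h1
    rw [← h1, ← Matrix.mulVec_mulVec, hpk, Matrix.mulVec_zero]
  have hdet' : (K.map (Rat.cast : ℚ → ℝ)).det ≠ 0 := by
    have := RingHom.map_det (Rat.castHom ℝ) K
    have h2 : ((Rat.castHom ℝ).mapMatrix K) = K.map (Rat.cast : ℚ → ℝ) := rfl
    rw [h2] at this
    rw [← this]
    simpa using hdet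
  -- Being a left eigenvector, `w` is orthogonal to the whole orbit `Bʲk`, hence to the columns of
  -- an invertible matrix.
  have hmul : ∀ j : ℕ, w ⬝ᵥ (fun i => (((B ^ j).mulVec k) i : ℝ)) = 0 := by
    intro j
    induction j with
    | zero => simpa using hwk
    | succ j ih =>
      have h3 : (fun i => (((B ^ (j + 1)).mulVec k) i : ℝ)) =
          (B.map (Rat.cast : ℚ → ℝ)).mulVec (fun i => (((B ^ j).mulVec k) i : ℝ)) := by
        ext i
        rw [pow_succ', ← Matrix.mulVec_mulVec]
        generalize (B ^ j).mulVec k = y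
        simp [Matrix.mulVec, dotProduct]
      rw [h3, Matrix.dotProduct_mulVec, hw, smul_dotProduct, ih, smul_zero]
  by_contra hw0
  apply hdet'
  refine Matrix.exists_vecMul_eq_zero_iff.1 ⟨w, hw0, ?_⟩
  ext j
  exact hmul j

/-- A left eigenvector for a real eigenvalue. -/
theorem exists_left_eigenvector {M : Matrix (Fin 3) (Fin 3) ℝ} {r : ℝ} (h : M.charpoly.IsRoot r) :
    ∃ v : Fin 3 → ℝ, v ≠ 0 ∧ Matrix.vecMul v M = r • v := by
  rw [Polynomial.IsRoot, Matrix.eval_charpoly] at h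
  obtain ⟨v, hv, h⟩ := Matrix.exists_vecMul_eq_zero_iff.2 h
  refine ⟨v, hv, ?_⟩
  rw [Matrix.vecMul_sub, sub_eq_zero] at h
  rw [← h]
  ext i
  simp [Matrix.vecMul_diagonal, mul_comm]

theorem isEigenvalue_ofReal (A : GL (Fin 3) ℤ) (r : ℝ) :
    IsEigenvalue A (r : ℂ) ↔
      ((A : Matrix (Fin 3) (Fin 3) ℤ).map (Int.cast : ℤ → ℝ)).charpoly.IsRoot r := by
  have h : ((A : Matrix (Fin 3) (Fin 3) ℤ).map (Int.cast : ℤ → ℂ)) =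
      (((A : Matrix (Fin 3) (Fin 3) ℤ).map (Int.cast : ℤ → ℝ)).map Complex.ofRealHom) := by
    ext i j
    simp
  rw [IsEigenvalue, h, Matrix.charpoly_map, Polynomial.IsRoot, Polynomial.eval_map]
  have : Polynomial.eval₂ Complex.ofRealHom (r : ℂ)
      ((A : Matrix (Fin 3) (Fin 3) ℤ).map (Int.cast : ℤ → ℝ)).charpoly =
      Complex.ofRealHom (Polynomial.eval r
        ((A : Matrix (Fin 3) (Fin 3) ℤ).map (Int.cast : ℤ → ℝ)).charpoly) :=
    Polynomial.eval₂_at_apply _ _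
  rw [this]
  simp [Polynomial.IsRoot]

/-- The eigenvalues `a < b < 1 < c`. -/
theorem exists_ordered_eigenvalues (A : GL (Fin 3) ℤ)
    (hhyp : IsHyperbolicMatrix A)
    (hreal : ∀ z : ℂ, IsEigenvalue A z → ∃ r : ℝ, z = (r : ℂ) ∧ 0 < r ∧ Irrational r)
    (hsimple : HasSimpleEigenvalues A)
    (hone : ∃! r : ℝ, IsEigenvalue A (r : ℂ) ∧ 1 < r) :
    ∃ a b c : ℝ, 0 < a ∧ a < b ∧ b < 1 ∧ 1 < c ∧ IsEigenvalue A (a : ℂ) ∧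
      IsEigenvalue A (b : ℂ) ∧ IsEigenvalue A (c : ℂ) := by
  obtain ⟨c, ⟨hc, hc1⟩, huniq⟩ := hone
  set χ := ((A : Matrix (Fin 3) (Fin 3) ℤ).map (Int.cast : ℤ → ℂ)).charpoly with hχ
  have hχ0 : χ ≠ 0 := (Matrix.charpoly_monic _).ne_zero
  have hcard : χ.roots.card = 3 := by
    rw [IsAlgClosed.card_roots_eq_natDegree, hχ]
    simp
  have hmem : ∀ z, z ∈ χ.roots ↔ IsEigenvalue A z := fun z => Polynomial.mem_roots hχ0
  obtain ⟨t, ht⟩ := Multiset.exists_cons_of_mem ((hmem _).2 hc)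
  have htcard : t.card = 2 := by
    rw [ht, Multiset.card_cons] at hcard
    omega
  obtain ⟨x, y, rfl⟩ := Multiset.card_eq_two.1 htcard
  have hnd : χ.roots.Nodup := hsimple
  rw [ht] at hnd
  have hx : IsEigenvalue A x := (hmem _).1 (by rw [ht]; simp)
  have hy : IsEigenvalue A y := (hmem _).1 (by rw [ht]; simp)
  have key : ∀ z : ℂ, IsEigenvalue A z → z ≠ (c : ℂ) → ∃ r : ℝ, z = r ∧ 0 < r ∧ r < 1 := by
    intro z hz hzc
    obtain ⟨r, rfl, hr0, -⟩ := hreal z hz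
    refine ⟨r, rfl, hr0, ?_⟩
    have h1 : r ≠ 1 := by
      intro h
      have := hhyp _ hz
      rw [h] at this
      simp at this
    by_contra h2
    have h3 : 1 < r := lt_of_le_of_ne (not_lt.1 h2) (Ne.symm h1)
    exact hzc (by rw [huniq r ⟨hz, h3⟩])
  simp only [Multiset.insert_eq_cons, Multiset.nodup_cons, Multiset.mem_cons,
    Multiset.mem_singleton, not_or] at hnd
  obtain ⟨⟨hcx, hcy⟩, hxy, -⟩ := hnd
  obtain ⟨p, rfl, hp0, hp1⟩ := key x hx (Ne.symm hcx)
  obtain ⟨q, rfl, hq0, hq1⟩ := key y hy (Ne.symm hcy)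
  have hpq : p ≠ q := fun h => hxy (by rw [h])
  rcases lt_or_gt_of_ne hpq with h | h
  · exact ⟨p, q, c, hp0, h, hq1, hc1, hx, hy, hc⟩
  · exact ⟨q, p, c, hq0, h, hp1, hc1, hy, hx, hc⟩

/-- Real eigencoordinates, in which a nonzero integer vector has no vanishing coordinate. -/
theorem exists_eigencoordinates (A : GL (Fin 3) ℤ)
    (hhyp : IsHyperbolicMatrix A)
    (hreal : ∀ z : ℂ, IsEigenvalue A z → ∃ r : ℝ, z = (r : ℂ) ∧ 0 < r ∧ Irrational r)
    (hsimple : HasSimpleEigenvalues A)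
    (hone : ∃! r : ℝ, IsEigenvalue A (r : ℂ) ∧ 1 < r) :
    ∃ (l : Fin 3 → ℝ) (P : Matrix (Fin 3) (Fin 3) ℝ), 0 < l 0 ∧ l 0 < l 1 ∧ l 1 < 1 ∧ 1 < l 2 ∧
      P.det ≠ 0 ∧
      P * (A : Matrix (Fin 3) (Fin 3) ℤ).map (Int.cast : ℤ → ℝ) = Matrix.diagonal l * P ∧
      ∀ m : Fin 3 → ℤ, m ≠ 0 → ∀ i, P.mulVec (fun j => (m j : ℝ)) i ≠ 0 := by
  obtain ⟨a, b, c, ha, hab, hb, hc, hA, hB, hC⟩ :=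
    exists_ordered_eigenvalues A hhyp hreal hsimple hone
  set M := (A : Matrix (Fin 3) (Fin 3) ℤ).map (Int.cast : ℤ → ℝ) with hM
  set l : Fin 3 → ℝ := ![a, b, c] with hl
  have hl0 : l 0 = a := rfl
  have hl1 : l 1 = b := rfl
  have hl2 : l 2 = c := rfl
  have hroot : ∀ i, M.charpoly.IsRoot (l i) := by
    intro i
    rw [← isEigenvalue_ofReal]
    fin_cases i
    exacts [hA, hB, hC]
  choose v hv0 hv using fun i => exists_left_eigenvector (hroot i)
  have hinj : Function.Injective l := by
    intro i j hij
    fin_cases i <;> fin_cases j <;> simp [hl] at hij ⊢ <;> linarith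
  have hlin : LinearIndependent ℝ v := by
    refine Module.End.eigenvectors_linearIndependent' (Matrix.vecMulLinear M) l hinj v ?_
    intro i
    exact Module.End.hasEigenvector_iff.2 ⟨Module.End.mem_eigenspace_iff.2 (hv i), hv0 i⟩
  refine ⟨l, Matrix.of v, ha, hab, hb, hc, ?_, ?_, ?_⟩
  · exact ((Matrix.isUnit_iff_isUnit_det _).1
      (Matrix.linearIndependent_rows_iff_isUnit.1 hlin)).ne_zero
  · ext i j
    rw [Matrix.diagonal_mul]
    exact congrFun (hv i) j
  · intro m hm i h
    have hq : (A : Matrix (Fin 3) (Fin 3) ℤ).map (Int.cast : ℤ → ℝ) =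
        ((A : Matrix (Fin 3) (Fin 3) ℤ).map (Int.cast : ℤ → ℚ)).map (Rat.cast : ℚ → ℝ) := by
      ext i j
      simp
    refine hv0 i (left_eigenvector_eq_zero_of_orthogonal
      (B := (A : Matrix (Fin 3) (Fin 3) ℤ).map (Int.cast : ℤ → ℚ)) (k := fun j => (m j : ℚ))
      (r := l i) ?_ ?_ ?_ ?_)
    · intro x hx
      have hx' : M.charpoly.IsRoot (x : ℝ) := by
        rw [hM, hq]
        have := Matrix.charpoly_map ((A : Matrix (Fin 3) (Fin 3) ℤ).map (Int.cast : ℤ → ℚ))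
          (Rat.castHom ℝ)
        rw [Rat.coe_castHom] at this
        rw [this]
        exact hx.map (f := Rat.castHom ℝ)
      rw [← isEigenvalue_ofReal] at hx'
      obtain ⟨r, hr, -, hirr⟩ := hreal _ hx'
      rw [Complex.ofReal_inj] at hr
      exact hirr ⟨x, hr⟩
    · intro h0
      apply hm
      ext j
      have := congrFun h0 j
      simpa using this
    · rw [← hq]
      exact hv i
    · simpa [Matrix.mulVec] using h

/-! ### The covering `ℝ³ → 𝕋³` -/

theorem torusProj_add (v w : E3) : torusProj (v + w) = torusProj v + torusProj w := by
  ext i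
  simp [torusProj]

theorem torusProj_zero : torusProj 0 = 0 := by
  ext i
  simp [torusProj]

theorem torusProj_eq_zero_iff (v : E3) : torusProj v = 0 ↔ ∀ i, ∃ n : ℤ, (n : ℝ) = v i := by
  rw [funext_iff]
  refine forall_congr' fun i => ?_
  change ((v i : ℝ) : UnitAddCircle) = 0 ↔ _
  rw [AddCircle.coe_eq_zero_iff]
  simp

theorem norm_torusProj_le (v : E3) : ‖torusProj v‖ ≤ ‖v‖ := by
  rw [pi_norm_le_iff_of_nonneg (norm_nonneg _)]
  intro i
  refine le_trans ?_ (PiLp.norm_apply_le v i)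
  change ‖((v i : ℝ) : UnitAddCircle)‖ ≤ _
  rw [UnitAddCircle.norm_eq, Real.norm_eq_abs]
  simpa using round_le (v i) 0

theorem exists_torusProj_eq (x : T3) : ∃ v : E3, torusProj v = x ∧ ‖v‖ ≤ 2 * ‖x‖ := by
  have h : ∀ y : UnitAddCircle, ∃ r : ℝ, (r : UnitAddCircle) = y ∧ |r| = ‖y‖ := by
    intro y
    obtain ⟨r, rfl⟩ := QuotientAddGroup.mk_surjective y
    refine ⟨r - round r, ?_, UnitAddCircle.norm_eq.symm⟩
    have h1 : ((round r : ℝ) : UnitAddCircle) = 0 :=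
      (AddCircle.coe_eq_zero_iff _).2 ⟨round r, by simp⟩
    rw [AddCircle.coe_sub, h1, sub_zero]
  choose r hr hr' using fun i => h (x i)
  refine ⟨WithLp.toLp 2 r, funext hr, ?_⟩
  -- The torus carries the sup norm, so three coordinates cost a factor `√3 ≤ 2`.
  rw [EuclideanSpace.norm_eq, Real.sqrt_le_left (by positivity), Fin.sum_univ_three]
  have h3 : ∀ i, ‖(WithLp.toLp 2 r : E3) i‖ ^ 2 ≤ ‖x‖ ^ 2 := by
    intro i
    refine pow_le_pow_left₀ (norm_nonneg _) ?_ 2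
    change |r i| ≤ _
    rw [hr' i]
    exact norm_le_pi_norm x i
  nlinarith [h3 0, h3 1, h3 2, sq_nonneg ‖x‖]

theorem homeomorph_zpow_add_one_apply {X : Type*} [TopologicalSpace X] (f : X ≃ₜ X) (n : ℤ)
    (x : X) : (f ^ (n + 1)) x = f ((f ^ n) x) := by
  rw [zpow_add_one, (Commute.zpow_self f n).eq]
  rfl

theorem homeomorph_zpow_add_apply {X : Type*} [TopologicalSpace X] (f : X ≃ₜ X) (m n : ℤ)
    (x : X) : (f ^ (m + n)) x = (f ^ m) ((f ^ n) x) := by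
  rw [zpow_add]
  rfl

theorem homeomorph_zpow_neg_apply_eq_iff {X : Type*} [TopologicalSpace X] (f : X ≃ₜ X) (n : ℤ)
    (x y : X) : (f ^ (-n)) x = y ↔ x = (f ^ n) y := by
  constructor
  · rintro rfl
    rw [← homeomorph_zpow_add_apply]
    simp
  · rintro rfl
    rw [← homeomorph_zpow_add_apply]
    simp

theorem zpow_mem_iff {X : Type*} [TopologicalSpace X] {f : X ≃ₜ X} {s : Set X}
    (h : f '' s = s) (n : ℤ) (x : X) : (f ^ n) x ∈ s ↔ x ∈ s := by
  have h1 : ∀ y, f y ∈ s ↔ y ∈ s := by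
    intro y
    nth_rw 1 [← h]
    exact f.injective.mem_set_image
  induction n generalizing x with
  | zero => simp
  | succ n ih => exact (by rw [homeomorph_zpow_add_one_apply, h1] : _ ↔ _).trans (ih x)
  | pred n ih =>
    refine Iff.trans ?_ (ih x)
    rw [← h1, ← homeomorph_zpow_add_one_apply, sub_add_cancel]

/-! ### Diagonal coordinates on the universal cover. -/

/-- Coordinates adapted to a toral automorphism with two stable directions and one unstable
direction; the first component is the stable one. -/
abbrev StableUnstable : Type := (ℝ × ℝ) × ℝ

/-- The diagonal action of `n` iterations in eigencoordinates. -/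
noncomputable def diagIter (a b c : ℝ) (n : ℤ) (w : StableUnstable) : StableUnstable :=
  ((a ^ n * w.1.1, b ^ n * w.1.2), c ^ n * w.2)

/-- A presentation of an automorphism of `𝕋³` as a diagonal linear map in real eigencoordinates,
in which a nonzero period vector has no vanishing coordinate. -/
structure DiagonalCover (f : T3 ≃ₜ T3) where
  /-- The strong contraction rate. -/
  a : ℝ
  /-- The weak contraction rate. -/
  b : ℝ
  /-- The expansion rate. -/
  c : ℝ
  /-- The eigencoordinates. -/
  J : E3 ≃L[ℝ] StableUnstable
  a_pos : 0 < a
  a_lt_b : a < b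
  b_lt_one : b < 1
  one_lt_c : 1 < c
  map_add : ∀ x y, f (x + y) = f x + f y
  semiconj : ∀ w, f (torusProj (J.symm w)) = torusProj (J.symm (diagIter a b c 1 w))
  coord_ne_zero : ∀ w, w ≠ 0 → torusProj (J.symm w) = 0 → w.1.1 ≠ 0 ∧ w.1.2 ≠ 0 ∧ w.2 ≠ 0
  exists_period : ∃ w, w ≠ 0 ∧ torusProj (J.symm w) = 0

namespace DiagonalCover

variable {f : T3 ≃ₜ T3} (E : DiagonalCover f)

/-- The covering in eigencoordinates. -/
noncomputable def q : StableUnstable →+ T3 where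
  toFun w := torusProj (E.J.symm w)
  map_zero' := by rw [map_zero, torusProj_zero]
  map_add' v w := by rw [_root_.map_add, torusProj_add]

/-- The iterates in eigencoordinates. -/
noncomputable def D (n : ℤ) : StableUnstable →+ StableUnstable where
  toFun := diagIter E.a E.b E.c n
  map_zero' := by simp [diagIter]
  map_add' v w := by simp [diagIter, mul_add]

/-- A constant comparing the metrics of `𝕋³` and of the eigencoordinates. -/
noncomputable def K : ℝ :=
  ‖(E.J.symm : StableUnstable →L[ℝ] E3)‖ + 2 * ‖(E.J : E3 →L[ℝ] StableUnstable)‖ + 1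

theorem b_pos : 0 < E.b := E.a_pos.trans E.a_lt_b

theorem a_lt_one : E.a < 1 := E.a_lt_b.trans E.b_lt_one

theorem c_pos : 0 < E.c := zero_lt_one.trans E.one_lt_c

theorem K_pos : 0 < E.K := by
  unfold K
  positivity

@[simp] theorem D_fst_fst (n : ℤ) (w : StableUnstable) : (E.D n w).1.1 = E.a ^ n * w.1.1 := rfl

@[simp] theorem D_fst_snd (n : ℤ) (w : StableUnstable) : (E.D n w).1.2 = E.b ^ n * w.1.2 := rfl

@[simp] theorem D_snd (n : ℤ) (w : StableUnstable) : (E.D n w).2 = E.c ^ n * w.2 := rfl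

theorem D_add (m n : ℤ) (w : StableUnstable) : E.D (m + n) w = E.D m (E.D n w) := by
  have ha := E.a_pos.ne'
  have hb := E.b_pos.ne'
  have hc := E.c_pos.ne'
  refine Prod.ext (Prod.ext ?_ ?_) ?_
  · simp only [D_fst_fst, zpow_add₀ ha, mul_assoc]
  · simp only [D_fst_snd, zpow_add₀ hb, mul_assoc]
  · simp only [D_snd, zpow_add₀ hc, mul_assoc]

theorem D_zero (w : StableUnstable) : E.D 0 w = w := by
  refine Prod.ext (Prod.ext ?_ ?_) ?_ <;> simp

theorem D_D_neg (n : ℤ) (w : StableUnstable) : E.D n (E.D (-n) w) = w := by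
  rw [← D_add, add_neg_cancel, D_zero]

theorem norm_D_le (n : ℤ) : ∃ M > 0, ∀ w, ‖E.D n w‖ ≤ M * ‖w‖ := by
  have ha := zpow_pos E.a_pos n
  have hb := zpow_pos E.b_pos n
  have hc := zpow_pos E.c_pos n
  refine ⟨E.a ^ n + E.b ^ n + E.c ^ n, by positivity, fun w => ?_⟩
  have h1 : ‖w.1.1‖ ≤ ‖w‖ := (norm_fst_le w.1).trans (norm_fst_le w)
  have h2 : ‖w.1.2‖ ≤ ‖w‖ := (norm_snd_le w.1).trans (norm_fst_le w)
  have h3 : ‖w.2‖ ≤ ‖w‖ := norm_snd_le w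
  rw [norm_prod_le_iff, norm_prod_le_iff]
  simp only [D_fst_fst, D_fst_snd, D_snd, norm_mul, Real.norm_of_nonneg ha.le,
    Real.norm_of_nonneg hb.le, Real.norm_of_nonneg hc.le]
  refine ⟨⟨?_, ?_⟩, ?_⟩ <;> nlinarith [norm_nonneg w]

theorem norm_q_le (w : StableUnstable) : ‖E.q w‖ ≤ E.K * ‖w‖ := by
  refine (norm_torusProj_le _).trans
    (((E.J.symm : StableUnstable →L[ℝ] E3).le_opNorm w).trans ?_)
  refine mul_le_mul_of_nonneg_right ?_ (norm_nonneg _)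
  unfold K
  linarith [norm_nonneg (E.J : E3 →L[ℝ] StableUnstable)]

theorem exists_lift (x : T3) : ∃ w, E.q w = x ∧ ‖w‖ ≤ E.K * ‖x‖ := by
  obtain ⟨v, hv, hx⟩ := exists_torusProj_eq x
  refine ⟨E.J v, ?_, ?_⟩
  · simpa [q] using hv
  · refine ((E.J : E3 →L[ℝ] StableUnstable).le_opNorm v).trans ?_
    refine (mul_le_mul_of_nonneg_left hx (norm_nonneg _)).trans ?_
    rw [← mul_assoc]
    refine mul_le_mul_of_nonneg_right ?_ (norm_nonneg _)
    unfold K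
    linarith [norm_nonneg (E.J.symm : StableUnstable →L[ℝ] E3)]

theorem dist_q_le (v w : StableUnstable) : dist (E.q v) (E.q w) ≤ E.K * ‖v - w‖ := by
  rw [dist_eq_norm, ← map_sub]
  exact E.norm_q_le _

theorem continuous_q : Continuous E.q := by
  refine (LipschitzWith.of_dist_le_mul (K := ⟨E.K, E.K_pos.le⟩) fun v w => ?_).continuous
  rw [dist_eq_norm v w]
  exact E.dist_q_le v w

theorem exists_lift_near (v : StableUnstable) (x : T3) :
    ∃ w, E.q w = x ∧ ‖w - v‖ ≤ E.K * dist x (E.q v) := by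
  obtain ⟨w, hw, hx⟩ := E.exists_lift (x - E.q v)
  refine ⟨w + v, ?_, ?_⟩
  · rw [_root_.map_add, hw, sub_add_cancel]
  · rwa [add_sub_cancel_right, dist_eq_norm]

/-- Periods correspond to integer vectors, and `K` bounds `‖J.symm‖`, so the integer coordinates
here have absolute value below `1`. -/
theorem eq_zero_of_q_eq_zero {w : StableUnstable} (h : E.q w = 0) (hw : E.K * ‖w‖ < 1) :
    w = 0 := by
  have h1 := (torusProj_eq_zero_iff _).1 h
  have h2 : ‖E.J.symm w‖ < 1 := by
    refine lt_of_le_of_lt (((E.J.symm : StableUnstable →L[ℝ] E3).le_opNorm w).trans ?_) hw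
    refine mul_le_mul_of_nonneg_right ?_ (norm_nonneg _)
    unfold K
    linarith [norm_nonneg (E.J : E3 →L[ℝ] StableUnstable)]
  have h3 : E.J.symm w = 0 := by
    ext i
    obtain ⟨n, hn⟩ := h1 i
    have h4 := (PiLp.norm_apply_le (E.J.symm w) i).trans_lt h2
    rw [← hn] at h4 ⊢
    rw [Real.norm_eq_abs, ← Int.cast_abs] at h4
    have : |n| < 1 := by exact_mod_cast h4
    rw [Int.abs_lt_one_iff] at this
    simp [this]
  simpa using h3

theorem zpow_add_apply {f : T3 ≃ₜ T3} (E : DiagonalCover f) (n : ℤ) (x y : T3) :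
    (f ^ n) (x + y) = (f ^ n) x + (f ^ n) y := by
  induction n generalizing x y with
  | zero => simp
  | succ n ih => simp only [homeomorph_zpow_add_one_apply, ih, E.map_add]
  | pred n ih =>
    apply f.injective
    rw [E.map_add, ← homeomorph_zpow_add_one_apply, ← homeomorph_zpow_add_one_apply,
      ← homeomorph_zpow_add_one_apply, sub_add_cancel]
    exact ih x y

theorem zpow_q (n : ℤ) (w : StableUnstable) : (f ^ n) (E.q w) = E.q (E.D n w) := by
  induction n generalizing w with
  | zero => simp [D_zero]
  | succ n ih =>
    rw [homeomorph_zpow_add_one_apply, ih, add_comm, D_add]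
    exact E.semiconj _
  | pred n ih =>
    apply f.injective
    rw [← homeomorph_zpow_add_one_apply, sub_add_cancel, ih]
    refine Eq.trans ?_ (E.semiconj _).symm
    change _ = E.q (E.D 1 (E.D _ w))
    rw [← D_add]
    congr 2
    ring_nf

theorem q_D_eq_zero {w : StableUnstable} (h : E.q w = 0) (n : ℤ) : E.q (E.D n w) = 0 := by
  rw [← zpow_q, h]
  have := E.zpow_add_apply n 0 0
  simpa using this

/-! ### Density of the unstable line -/

/-- A closed subgroup with small elements contains the limits of their real multiples. -/
theorem _root_.AddSubgroup.mem_of_tendsto_smul {V : Type*} [NormedAddCommGroup V]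
    [NormedSpace ℝ V] (H : AddSubgroup V) (hH : IsClosed (H : Set V)) {h : ℕ → V}
    (hmem : ∀ n, h n ∈ H) (h0 : Tendsto h atTop (𝓝 0)) {t : ℕ → ℝ} {w : V}
    (hw : Tendsto (fun n => t n • h n) atTop (𝓝 w)) : w ∈ H := by
  -- Replacing the real multiple by its integer part costs at most `‖h n‖`.
  have h1 : Tendsto (fun n => Int.fract (t n) • h n) atTop (𝓝 0) := by
    refine squeeze_zero_norm (a := fun n => ‖h n‖) (fun n => ?_) (by simpa using h0.norm)
    rw [norm_smul, Real.norm_of_nonneg (Int.fract_nonneg _)]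
    exact mul_le_of_le_one_left (norm_nonneg _) (Int.fract_lt_one _).le
  have h2 : Tendsto (fun n => ⌊t n⌋ • h n) atTop (𝓝 w) := by
    have := hw.sub h1
    rw [sub_zero] at this
    refine this.congr fun n => ?_
    rw [← sub_smul, Int.self_sub_fract, Int.cast_smul_eq_zsmul]
  exact hH.mem_of_tendsto h2 (Eventually.of_forall fun n => H.zsmul_mem (hmem n) _)

/-- The preimage `H` of the closure is a closed subgroup containing the unstable axis and all
periods. Iterating a period and removing its unstable part gives small elements of `H` in the stable
plane. Since `a < b`, their directions tend to the weak axis, so that axis lies in `H`; subtracting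
it leaves small elements on the strong axis, which therefore lies in `H` too. -/
theorem dense_unstable_line : Dense (range fun t : ℝ => E.q ((0, 0), t)) := by
  set i : ℝ →+ StableUnstable :=
    { toFun := fun t => ((0, 0), t)
      map_zero' := rfl
      map_add' := by intro s t; simp } with hi
  set G := (E.q.comp i).range.topologicalClosure with hG
  set H := G.comap E.q with hH
  have hHc : IsClosed (H : Set StableUnstable) :=
    (AddSubgroup.isClosed_topologicalClosure _).preimage E.continuous_q
  have hu : ∀ t : ℝ, (((0, 0), t) : StableUnstable) ∈ H := fun t =>
    AddSubgroup.le_topologicalClosure _ ⟨t, rfl⟩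
  obtain ⟨m, hm0, hm⟩ := E.exists_period
  obtain ⟨hx, hy, -⟩ := E.coord_ne_zero m hm0 hm
  have hab : Tendsto (fun n : ℕ => (E.a / E.b) ^ n) atTop (𝓝 0) :=
    tendsto_pow_atTop_nhds_zero_of_lt_one (div_pos E.a_pos E.b_pos).le
      ((div_lt_one E.b_pos).2 E.a_lt_b)
  have haz : Tendsto (fun n : ℕ => E.a ^ n) atTop (𝓝 0) :=
    tendsto_pow_atTop_nhds_zero_of_lt_one E.a_pos.le E.a_lt_one
  have hbz : Tendsto (fun n : ℕ => E.b ^ n) atTop (𝓝 0) :=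
    tendsto_pow_atTop_nhds_zero_of_lt_one E.b_pos.le E.b_lt_one
  have hmem : ∀ n : ℕ, (((E.a ^ n * m.1.1, E.b ^ n * m.1.2), 0) : StableUnstable) ∈ H := by
    intro n
    have h1 : E.D n m ∈ H := by
      rw [hH, AddSubgroup.mem_comap, E.q_D_eq_zero hm]
      exact G.zero_mem
    convert H.sub_mem h1 (hu (E.c ^ n * m.2)) using 1
    refine Prod.ext (Prod.ext ?_ ?_) ?_ <;> simp
  have hb : ∀ t : ℝ, (((0, t), 0) : StableUnstable) ∈ H := by
    intro t
    refine H.mem_of_tendsto_smul hHc hmem (t := fun n => t / (E.b ^ n * m.1.2)) ?_ ?_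
    · have := (((haz.mul_const m.1.1).prodMk_nhds (hbz.mul_const m.1.2)).prodMk_nhds
        (tendsto_const_nhds (x := (0 : ℝ))))
      rw [zero_mul, zero_mul] at this
      exact this
    · have := (((hab.mul_const (t * m.1.1 / m.1.2)).prodMk_nhds
        (tendsto_const_nhds (x := t))).prodMk_nhds (tendsto_const_nhds (x := (0 : ℝ))))
      rw [zero_mul] at this
      refine this.congr fun n => ?_
      have hbn := (pow_pos E.b_pos n).ne'
      refine Prod.ext (Prod.ext ?_ ?_) ?_
      · simp only [Prod.smul_fst, smul_eq_mul, div_pow]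
        field_simp
      · simp only [Prod.smul_fst, Prod.smul_snd, smul_eq_mul]
        field_simp
      · simp
  have ha : ∀ t : ℝ, (((t, 0), 0) : StableUnstable) ∈ H := by
    intro t
    refine H.mem_of_tendsto_smul hHc (h := fun n : ℕ => ((E.a ^ n * m.1.1, 0), 0)) ?_
      (t := fun n => t / (E.a ^ n * m.1.1)) ?_ ?_
    · intro n
      convert H.sub_mem (hmem n) (hb (E.b ^ n * m.1.2)) using 1
      refine Prod.ext (Prod.ext ?_ ?_) ?_ <;> simp
    · have := (((haz.mul_const m.1.1).prodMk_nhds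
        (tendsto_const_nhds (x := (0 : ℝ)))).prodMk_nhds (tendsto_const_nhds (x := (0 : ℝ))))
      rw [zero_mul] at this
      exact this
    · refine tendsto_const_nhds.congr fun n => ?_
      have han := (pow_pos E.a_pos n).ne'
      refine Prod.ext (Prod.ext ?_ ?_) ?_
      · simp only [Prod.smul_fst, smul_eq_mul]
        field_simp
      · simp
      · simp
  intro x
  obtain ⟨w, rfl, -⟩ := E.exists_lift x
  have : w ∈ H := by
    convert H.add_mem (H.add_mem (ha w.1.1) (hb w.1.2)) (hu w.2) using 1
    refine Prod.ext (Prod.ext ?_ ?_) ?_ <;> simp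
  have h2 : E.q w ∈ (G : Set T3) := this
  rw [hG, AddSubgroup.topologicalClosure_coe] at h2
  have h3 : (range fun t : ℝ => E.q ((0, 0), t)) = ((E.q.comp i).range : Set T3) := rfl
  rwa [h3]

end DiagonalCover

/-! ### Fine chains -/

/-- `w ∈ L` is reached from `0` by a chain in `L` with steps smaller than `η`, inside the ball
of radius `R`. -/
def Reach (L : Set StableUnstable) (η R : ℝ) (w : StableUnstable) : Prop :=
  Relation.ReflTransGen (fun u v => v ∈ L ∧ ‖v‖ ≤ R ∧ ‖v - u‖ < η) 0 w

/-- `y` is reached from `0` by arbitrarily fine chains in a bounded part of `L`. -/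
def FinelyReach (L : Set StableUnstable) (y : StableUnstable) : Prop :=
  ∃ R, 0 ≤ R ∧ ∀ η > 0, Reach L η R y

/-- A set that is closed under the bracket of points at distance less than `δ`. -/
def BracketClosed (S : Set StableUnstable) (δ : ℝ) : Prop :=
  ∀ v ∈ S, ∀ w ∈ S, ‖v - w‖ < δ → (w.1, v.2) ∈ S

section Chains

variable {L : Set StableUnstable} {η R : ℝ}

theorem Reach.mem {w : StableUnstable} (h : Reach L η R w) (h0 : 0 ∈ L) (hR : 0 ≤ R) :
    w ∈ L ∧ ‖w‖ ≤ R := by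
  rcases Relation.ReflTransGen.cases_tail h with h | ⟨v, -, h⟩
  · rw [h]
    simpa using ⟨h0, hR⟩
  · exact ⟨h.1, h.2.1⟩

theorem Reach.mono {η' : ℝ} (hη : η ≤ η') {w : StableUnstable} (h : Reach L η R w) :
    Reach L η' R w :=
  Relation.ReflTransGen.mono (fun _ _ h => ⟨h.1, h.2.1, h.2.2.trans_le hη⟩) _ _ h

theorem Reach.map_D {f : T3 ≃ₜ T3} (E : DiagonalCover f) (hL : ∀ n w, E.D n w ∈ L ↔ w ∈ L)
    {n : ℤ} {M : ℝ} (hM : 0 < M) (hn : ∀ w, ‖E.D n w‖ ≤ M * ‖w‖) {w : StableUnstable}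
    (h : Reach L η R w) : Reach L (M * η) (M * R) (E.D n w) := by
  have h1 := Relation.ReflTransGen.lift (p := fun u v => v ∈ L ∧ ‖v‖ ≤ M * R ∧ ‖v - u‖ < M * η)
    (E.D n) (fun u v h => ?_) _ _ h
  · rw [Function.onFun, map_zero] at h1
    exact h1
  · refine ⟨(hL n v).2 h.1, (hn v).trans (by gcongr; exact h.2.1), ?_⟩
    rw [← map_sub]
    exact (hn _).trans_lt (by gcongr; exact h.2.2)

theorem FinelyReach.map_D {f : T3 ≃ₜ T3} (E : DiagonalCover f) (hL : ∀ n w, E.D n w ∈ L ↔ w ∈ L)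
    {w : StableUnstable} (h : FinelyReach L w) (n : ℤ) : FinelyReach L (E.D n w) := by
  obtain ⟨M, hM, hn⟩ := E.norm_D_le n
  obtain ⟨R, hR, h⟩ := h
  refine ⟨M * R, by positivity, fun η hη => ?_⟩
  have := (h (η / M) (by positivity)).map_D E hL hM hn
  rwa [mul_div_cancel₀ _ hM.ne'] at this

/-- Compactness: the common bound `R` lets endpoints of ever finer chains accumulate, and one extra
short step reaches the limit, which thus works for every `η`. -/
theorem exists_finely_reached {S : Set StableUnstable} (hS : IsClosed S) (hL : IsClosed L)
    (h0 : 0 ∈ L) (hR : 0 ≤ R) (h : ∀ η > 0, ∃ w ∈ S, Reach L η R w) :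
    ∃ y ∈ S, ∀ η > 0, Reach L η R y := by
  choose w hwS hw using fun n : ℕ => h (1 / ((n : ℝ) + 1)) (by positivity)
  have hmem : ∀ n, w n ∈ Metric.closedBall 0 R ∩ (S ∩ L) := fun n =>
    ⟨by simpa using ((hw n).mem h0 hR).2, hwS n, ((hw n).mem h0 hR).1⟩
  obtain ⟨y, ⟨hyR, hyS, hyL⟩, φ, hφ, hlim⟩ :=
    ((isCompact_closedBall _ _).inter_right (hS.inter hL)).tendsto_subseq hmem
  refine ⟨y, hyS, fun η hη => ?_⟩
  have h1 : ∀ᶠ k in atTop, dist ((w ∘ φ) k) y < η := (Metric.tendsto_nhds.1 hlim) η hη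
  have h2 : ∀ᶠ k : ℕ in atTop, 1 / ((φ k : ℝ) + 1) < η :=
    hφ.tendsto_atTop.eventually (tendsto_one_div_add_atTop_nhds_zero_nat.eventually_lt_const hη)
  obtain ⟨k, hk1, hk2⟩ := (h1.and h2).exists
  refine Relation.ReflTransGen.tail ((hw (φ k)).mono hk2.le) ⟨hyL, by simpa using hyR, ?_⟩
  rw [← dist_eq_norm, dist_comm]
  exact hk1

/-- A discrete intermediate value property: the unstable coordinate cannot jump over `t` by `η` or
more in one step. -/
theorem Reach.exists_near {w : StableUnstable} (h : Reach L η R w) (hη : 0 < η) {t : ℝ}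
    (ht : t ∈ uIcc 0 w.2) : ∃ v, Reach L η R v ∧ |v.2 - t| < η := by
  induction h with
  | refl =>
    refine ⟨0, Relation.ReflTransGen.refl, ?_⟩
    have : t = 0 := by simpa using ht
    simpa [this] using hη
  | @tail u v huv hstep ih =>
    by_cases htu : t ∈ uIcc 0 u.2
    · exact ih htu
    · refine ⟨v, Relation.ReflTransGen.tail huv hstep, ?_⟩
      have h1 : |v.2 - u.2| < η := (norm_snd_le (v - u)).trans_lt hstep.2.2
      rw [abs_lt] at h1 ⊢
      rw [mem_uIcc] at ht htu
      push Not at htu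
      rcases ht with ht | ht <;> constructor <;> grind

end Chains

/-! ### From fine chains to unstable half-lines. -/

section Product

variable {f : T3 ≃ₜ T3} (E : DiagonalCover f) {L S : Set StableUnstable} {δ : ℝ}

theorem norm_D_fst_le (n : ℕ) (w : StableUnstable) : ‖(E.D n w).1‖ ≤ E.b ^ n * ‖w‖ := by
  have h1 : ‖w.1.1‖ ≤ ‖w‖ := (norm_fst_le w.1).trans (norm_fst_le w)
  have h2 : ‖w.1.2‖ ≤ ‖w‖ := (norm_snd_le w.1).trans (norm_fst_le w)
  have hab : E.a ^ n ≤ E.b ^ n := pow_le_pow_left₀ E.a_pos.le E.a_lt_b.le n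
  have ha := pow_pos E.a_pos n
  have hb := pow_pos E.b_pos n
  rw [norm_prod_le_iff]
  simp only [DiagonalCover.D_fst_fst, DiagonalCover.D_fst_snd, zpow_natCast, norm_mul,
    Real.norm_of_nonneg ha.le, Real.norm_of_nonneg hb.le]
  constructor <;> gcongr

/-- The unstable coordinate of a finely reached point is realized on the unstable line. -/
theorem exists_reach_unstable_mem (hS : ∀ n w, E.D n w ∈ S ↔ w ∈ S) (hδ : 0 < δ)
    (hbr : BracketClosed S δ) (hLS : L ⊆ S) (hL0 : 0 ∈ L) (R : ℝ) :
    ∃ η > 0, ∀ w, Reach L η R w → (((0, 0), w.2) : StableUnstable) ∈ S := by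
  obtain ⟨n, hn⟩ : ∃ n : ℕ, E.b ^ n * R < δ := by
    have h := (tendsto_pow_atTop_nhds_zero_of_lt_one E.b_pos.le E.b_lt_one).mul_const R
    rw [zero_mul] at h
    exact (h.eventually_lt_const hδ).exists
  have hc := pow_pos E.c_pos n
  -- After `n` iterations the ball of radius `R` lies within `δ` of the unstable axis, and this `η`
  -- keeps the stretched steps below `δ`; so the bracket can be followed along the axis.
  refine ⟨δ / E.c ^ n, by positivity, fun w hw => ?_⟩
  rw [← hS n]
  induction hw with
  | refl =>
    exact (hS n 0).2 (hLS hL0)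
  | @tail u v huv hstep ih =>
    obtain ⟨hvL, hvR, hd⟩ := hstep
    convert hbr _ ((hS n v).2 (hLS hvL)) _ ih ?_ using 1
    · refine Prod.ext (Prod.ext ?_ ?_) ?_ <;> simp
    · refine max_lt ?_ ?_
      · have h1 : (E.D n v - E.D n (((0, 0), u.2) : StableUnstable)).1 = (E.D n v).1 := by
          refine Prod.ext ?_ ?_ <;> simp
        change ‖(E.D n v - E.D n (((0, 0), u.2) : StableUnstable)).1‖ < δ
        rw [h1]
        refine (norm_D_fst_le E n v).trans_lt (lt_of_le_of_lt ?_ hn)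
        have := pow_pos E.b_pos n
        gcongr
      · change ‖E.c ^ (n : ℤ) * v.2 - E.c ^ (n : ℤ) * u.2‖ < δ
        rw [← mul_sub, norm_mul, zpow_natCast, Real.norm_of_nonneg hc.le, ← lt_div_iff₀' hc]
        exact (norm_snd_le (v - u)).trans_lt hd

/-- Forward iterates of the segment exhaust a half-axis, on the side given by the sign of `s`. -/
theorem unstable_ray_mem_of_segment (hS : ∀ n w, E.D n w ∈ S ↔ w ∈ S) {s : ℝ} (hs : s ≠ 0)
    (h : ∀ t ∈ uIcc 0 s, (((0, 0), t) : StableUnstable) ∈ S) :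
    (∀ t : ℝ, 0 ≤ t → (((0, 0), t) : StableUnstable) ∈ S) ∨
      ∀ t : ℝ, t ≤ 0 → (((0, 0), t) : StableUnstable) ∈ S := by
  have key : ∀ t : ℝ, 0 ≤ t / s → (((0, 0), t) : StableUnstable) ∈ S := by
    intro t ht
    obtain ⟨n, hn⟩ := pow_unbounded_of_one_lt (t / s) E.one_lt_c
    have hc := pow_pos E.c_pos n
    rw [← hS (-n)]
    have h1 : E.D (-(n : ℤ)) (((0, 0), t) : StableUnstable) =
        ((0, 0), (t / s / E.c ^ n) * s) := by
      refine Prod.ext (Prod.ext ?_ ?_) ?_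
      · simp
      · simp
      · simp only [DiagonalCover.D_snd, zpow_neg, zpow_natCast]
        field_simp
    rw [h1]
    apply h
    have h2 : 0 ≤ t / s / E.c ^ n := by positivity
    have h3 : t / s / E.c ^ n ≤ 1 := by
      rw [div_le_one hc]
      exact hn.le
    rw [mem_uIcc]
    rcases lt_or_gt_of_ne hs with h4 | h4
    · right
      constructor <;> nlinarith
    · left
      constructor <;> nlinarith
  rcases lt_or_gt_of_ne hs with h4 | h4
  · exact Or.inr fun t ht => key t (div_nonneg_of_nonpos ht h4.le)
  · exact Or.inl fun t ht => key t (div_nonneg ht h4.le)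

/-- Unstable coordinates of chain points belong to the trace of `S` on the axis, and finer chains
pass ever closer to each intermediate `t`; closedness of `S` concludes. -/
theorem unstable_segment_mem (hSc : IsClosed S) (hS : ∀ n w, E.D n w ∈ S ↔ w ∈ S) (hδ : 0 < δ)
    (hbr : BracketClosed S δ) (hLS : L ⊆ S) (hL0 : 0 ∈ L) {y : StableUnstable}
    (hy : FinelyReach L y) : ∀ t ∈ uIcc 0 y.2, (((0, 0), t) : StableUnstable) ∈ S := by
  intro t ht
  obtain ⟨R, -, hR⟩ := hy
  obtain ⟨η, hη, hmem⟩ := exists_reach_unstable_mem E hS hδ hbr hLS hL0 R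
  have hcl : IsClosed {s : ℝ | (((0, 0), s) : StableUnstable) ∈ S} :=
    hSc.preimage (by fun_prop)
  have : t ∈ closure {s : ℝ | (((0, 0), s) : StableUnstable) ∈ S} := by
    rw [Metric.mem_closure_iff]
    intro ζ hζ
    obtain ⟨v, hv, hvt⟩ := (hR (min ζ η) (lt_min hζ hη)).exists_near (lt_min hζ hη) ht
    refine ⟨v.2, hmem v (hv.mono (min_le_right _ _)), ?_⟩
    rw [dist_comm, Real.dist_eq]
    exact hvt.trans_le (min_le_left _ _)
  rwa [hcl.closure_eq] at this

/-- Transport of unstable displacements along a chain in the stable plane. -/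
theorem mem_iff_of_finelyReach (hS : ∀ n w, E.D n w ∈ S ↔ w ∈ S) (hδ : 0 < δ)
    (hbr : BracketClosed S δ) (hLS : L ⊆ S) (hLc : IsClosed L) (hL0 : 0 ∈ L)
    (hL : ∀ n w, E.D n w ∈ L ↔ w ∈ L)
    (hst : ∀ y, FinelyReach L y → y.2 = 0) {y : StableUnstable} (hy : FinelyReach L y) (t : ℝ) :
    (((0, 0), t) : StableUnstable) ∈ S ↔ (y.1, t) ∈ S := by
  have small : ∀ t : ℝ, |t| < δ / 2 → ∀ y, FinelyReach L y →
      ((((0, 0), t) : StableUnstable) ∈ S ↔ (y.1, t) ∈ S) := by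
    intro t ht y hy
    obtain ⟨R, hR, hy⟩ := hy
    -- By compactness, fine enough chains stay close to the stable plane, since a limit of
    -- exceptions would be a finely reached point off it.
    obtain ⟨η, hη, hη'⟩ : ∃ η > 0, ∀ w, Reach L η R w → |w.2| < δ / 2 := by
      by_contra! hcon
      obtain ⟨z, hz, hzR⟩ := exists_finely_reached (S := {w : StableUnstable | δ / 2 ≤ |w.2|})
        (isClosed_le (by fun_prop) (by fun_prop)) hLc hL0 hR
        (fun η hη => (hcon η hη).imp fun w hw => ⟨hw.2, hw.1⟩)
      have h0 := hst z ⟨R, hR, hzR⟩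
      simp only [mem_ofPred_eq, h0, abs_zero] at hz
      linarith
    set η' := min η δ
    have hclose : ∀ u v : StableUnstable, |u.2| < δ / 2 → ‖v - u‖ < η' →
        ‖((v.1, t) : StableUnstable) - u‖ < δ ∧ ‖u - (v.1, t)‖ < δ := by
      intro u v hu huv
      have h1 : ‖((v.1, t) : StableUnstable) - u‖ < δ := by
        refine max_lt ?_ ?_
        · exact ((norm_fst_le (v - u)).trans_lt huv).trans_le (min_le_right _ _)
        · change |t - u.2| < δ
          exact (abs_sub _ _).trans_lt (by linarith)
      exact ⟨h1, by rwa [norm_sub_rev]⟩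
    have hchain := hy η' (lt_min hη hδ)
    have : ∀ w, Reach L η' R w →
        ((((0, 0), t) : StableUnstable) ∈ S ↔ (w.1, t) ∈ S) := by
      intro w hw
      induction hw with
      | refl => rfl
      | @tail u v huv hstep ih =>
        have hu := (Reach.mem huv hL0 hR).1
        have hu2 : |u.2| < δ / 2 := hη' u (Reach.mono (min_le_left _ _) huv)
        have hv2 : |v.2| < δ / 2 :=
          hη' v (Reach.mono (min_le_left _ _) (Relation.ReflTransGen.tail huv hstep))
        rw [ih]
        constructor
        · intro h
          exact hbr _ h _ (hLS hstep.1)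
            (hclose v u hv2 (by rw [norm_sub_rev]; exact hstep.2.2)).1
        · intro h
          exact hbr _ h _ (hLS hu) (hclose u v hu2 hstep.2.2).1
    exact this y hchain
  -- Backward iteration makes any `t` small, and `D (-n) y` is still finely reached, so the small
  -- case applies to it.
  obtain ⟨n, hn⟩ : ∃ n : ℕ, |t| * (E.c⁻¹) ^ n < δ / 2 := by
    have h := (tendsto_pow_atTop_nhds_zero_of_lt_one (inv_nonneg.2 E.c_pos.le)
      (inv_lt_one_of_one_lt₀ E.one_lt_c)).const_mul |t|
    rw [mul_zero] at h
    exact (h.eventually_lt_const (half_pos hδ)).exists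
  have hc := pow_pos E.c_pos n
  have h1 := small (E.c ^ (-(n : ℤ)) * t) (by
    rw [abs_mul, mul_comm, zpow_neg, zpow_natCast, abs_of_pos (inv_pos.2 hc), ← inv_pow]
    exact hn) _ (hy.map_D E hL (-(n : ℤ)))
  rw [← hS (-(n : ℤ)), ← hS (-(n : ℤ)) (y.1, t)]
  convert h1 using 2 <;> refine Prod.ext (Prod.ext ?_ ?_) ?_ <;> simp

/-- Expanding orbits come back: their points are arbitrarily close modulo periods. -/
theorem exists_near_period {y : StableUnstable} (hy0 : y ≠ 0) (hy : y.2 = 0) :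
    ∀ ζ > 0, ∃ (i j : ℤ) (m : StableUnstable), m ≠ 0 ∧ E.q m = 0 ∧
      ‖E.D i y - (E.D j y + m)‖ < ζ := by
  have hgap : ∀ l : ℝ, 0 < l → l < 1 → ∀ i j : ℕ, i < j → l⁻¹ - 1 ≤ (l⁻¹) ^ j - (l⁻¹) ^ i := by
    intro l h0 h1 i j hij
    have h2 : 1 < l⁻¹ := one_lt_inv_iff₀.2 ⟨h0, h1⟩
    have h3 : (l⁻¹) ^ (i + 1) ≤ (l⁻¹) ^ j := pow_le_pow_right₀ h2.le hij
    have h4 : 1 ≤ (l⁻¹) ^ i := one_le_pow₀ h2.le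
    rw [pow_succ] at h3
    nlinarith
  -- The backward orbit of a nonzero stable vector is uniformly separated in the cover; this is what
  -- makes the period found below nonzero.
  obtain ⟨κ, hκ, hsep⟩ : ∃ κ > 0, ∀ i j : ℕ, i < j →
      κ ≤ ‖E.D (-(j : ℤ)) y - E.D (-(i : ℤ)) y‖ := by
    by_cases h1 : y.1.1 = 0
    · have h2 : y.1.2 ≠ 0 := fun h2 => hy0 (Prod.ext (Prod.ext h1 h2) hy)
      have h3 : 0 < E.b⁻¹ - 1 := sub_pos.2 (one_lt_inv_iff₀.2 ⟨E.b_pos, E.b_lt_one⟩)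
      refine ⟨(E.b⁻¹ - 1) * |y.1.2|, by positivity, fun i j hij => ?_⟩
      refine le_trans ?_ ((norm_snd_le _).trans (norm_fst_le _))
      change _ ≤ |E.b ^ (-(j : ℤ)) * y.1.2 - E.b ^ (-(i : ℤ)) * y.1.2|
      rw [← sub_mul, abs_mul]
      gcongr
      refine le_trans ?_ (le_abs_self _)
      simpa using hgap E.b E.b_pos E.b_lt_one i j hij
    · have h3 : 0 < E.a⁻¹ - 1 := sub_pos.2 (one_lt_inv_iff₀.2 ⟨E.a_pos, E.a_lt_one⟩)
      refine ⟨(E.a⁻¹ - 1) * |y.1.1|, by positivity, fun i j hij => ?_⟩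
      refine le_trans ?_ ((norm_fst_le _).trans (norm_fst_le _))
      change _ ≤ |E.a ^ (-(j : ℤ)) * y.1.1 - E.a ^ (-(i : ℤ)) * y.1.1|
      rw [← sub_mul, abs_mul]
      gcongr
      refine le_trans ?_ (le_abs_self _)
      simpa using hgap E.a E.a_pos E.a_lt_one i j hij
  intro ζ hζ
  have hK := E.K_pos
  obtain ⟨x, -, φ, hφ, hlim⟩ := isCompact_univ.tendsto_subseq
    (x := fun n : ℕ => E.q (E.D (-(n : ℤ)) y)) (fun n => mem_univ _)
  obtain ⟨N, hN⟩ := Metric.cauchySeq_iff.1 hlim.cauchySeq (min ζ κ / E.K) (by positivity)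
  have hd := hN (N + 1) (by omega) N le_rfl
  set i := φ (N + 1)
  set j := φ N
  have hij : j < i := hφ (Nat.lt_succ_self N)
  obtain ⟨v, hv, hvn⟩ := E.exists_lift (E.q (E.D (-(i : ℤ)) y) - E.q (E.D (-(j : ℤ)) y))
  rw [← dist_eq_norm] at hvn
  have hvlt : ‖v‖ < min ζ κ := hvn.trans_lt (by rwa [← lt_div_iff₀' hK])
  -- The difference of two iterates that are close on the torus is a period plus a small lift `v`.
  -- If the period vanished, the difference would be shorter than `κ`.
  refine ⟨-i, -j, E.D (-(i : ℤ)) y - E.D (-(j : ℤ)) y - v, ?_, ?_, ?_⟩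
  · intro h0
    have h1 := hsep j i hij
    rw [sub_eq_zero.1 h0] at h1
    exact absurd (hvlt.trans_le (min_le_right _ _)) (not_lt.2 h1)
  · rw [map_sub, map_sub, hv, sub_self]
  · rw [show E.D (-(i : ℤ)) y - (E.D (-(j : ℤ)) y + (E.D (-(i : ℤ)) y - E.D (-(j : ℤ)) y - v)) = v
      by abel]
    exact hvlt.trans_le (min_le_left _ _)

/-- Carry a height `s` from the axis to one iterate of `y`, translate by the period `m`, bracket
over to the nearby other iterate, and carry it back: the height becomes `s + m.2`. Both signs are
available, and `m.2` is nonzero and arbitrarily small, so the heights in `S` are dense. -/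
theorem unstable_line_mem (hSc : IsClosed S) (hS : ∀ n w, E.D n w ∈ S ↔ w ∈ S) (hδ : 0 < δ)
    (hper : ∀ w m, E.q m = 0 → w ∈ S → w + m ∈ S)
    (hbr : BracketClosed S δ) (hLS : L ⊆ S) (hLc : IsClosed L) (hL0 : 0 ∈ L)
    (hL : ∀ n w, E.D n w ∈ L ↔ w ∈ L)
    (hst : ∀ y, FinelyReach L y → y.2 = 0) {y : StableUnstable} (hy : FinelyReach L y)
    (hy0 : y ≠ 0) (t : ℝ) : (((0, 0), t) : StableUnstable) ∈ S := by
  have htr := fun {z} (hz : FinelyReach L z) t =>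
    mem_iff_of_finelyReach E hS hδ hbr hLS hLc hL0 hL hst hz t
  have hstep : ∀ (m y₁ y₂ : StableUnstable), E.q m = 0 → FinelyReach L y₁ → FinelyReach L y₂ →
      ‖y₁ - (y₂ + m)‖ < δ → ∀ s : ℝ, (((0, 0), s) : StableUnstable) ∈ S →
        (((0, 0), s + m.2) : StableUnstable) ∈ S := by
    intro m y₁ y₂ hm hy₁ hy₂ hd s hs
    have h1 : (y₁.1, s) ∈ S := (htr hy₁ s).1 hs
    have h2 : (y₂.1 + m.1, s + m.2) ∈ S := hper _ m hm ((htr hy₂ s).1 hs)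
    refine (htr hy₁ _).2 (hbr _ h2 (y₁.1, s) h1 ?_)
    refine lt_of_eq_of_lt ?_ hd
    rw [norm_sub_rev]
    congr 1
    refine Prod.ext rfl ?_
    simp [hst y₁ hy₁, hst y₂ hy₂]
  have hcl : IsClosed {s : ℝ | (((0, 0), s) : StableUnstable) ∈ S} :=
    hSc.preimage (by fun_prop)
  have : t ∈ closure {s : ℝ | (((0, 0), s) : StableUnstable) ∈ S} := by
    rw [Metric.mem_closure_iff]
    intro ζ hζ
    obtain ⟨i, j, m, hm0, hm, hd⟩ := exists_near_period E hy0 (hst y hy) (min ζ δ)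
      (lt_min hζ hδ)
    have hmz := (E.coord_ne_zero m hm0 hm).2.2
    have hmlt : |m.2| < ζ := by
      refine lt_of_le_of_lt ?_ (hd.trans_le (min_le_left _ _))
      refine le_trans (le_of_eq ?_) (norm_snd_le _)
      simp [hst y hy]
    have hadd : ∀ s : ℝ, (((0, 0), s) : StableUnstable) ∈ S →
        (((0, 0), s + m.2) : StableUnstable) ∈ S :=
      hstep m _ _ hm (hy.map_D E hL i) (hy.map_D E hL j) (hd.trans_le (min_le_right _ _))
    have hsub : ∀ s : ℝ, (((0, 0), s) : StableUnstable) ∈ S →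
        (((0, 0), s - m.2) : StableUnstable) ∈ S := by
      intro s hs
      have := hstep (-m) _ _ (by rw [map_neg, hm, neg_zero]) (hy.map_D E hL j)
        (hy.map_D E hL i) (by
          refine lt_of_eq_of_lt ?_ (hd.trans_le (min_le_right _ _))
          rw [norm_sub_rev]
          congr 1
          abel) s hs
      simpa [sub_eq_add_neg] using this
    have hall : ∀ n : ℤ, (((0, 0), n * m.2) : StableUnstable) ∈ S := by
      intro n
      induction n with
      | zero =>
        rw [Int.cast_zero, zero_mul]
        exact hLS hL0
      | succ n ih =>
        have := hadd _ ih
        push_cast at this ⊢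
        rwa [add_mul, one_mul]
      | pred n ih =>
        have := hsub _ ih
        push_cast at this ⊢
        rwa [sub_mul, one_mul]
    refine ⟨_, hall ⌊t / m.2⌋, ?_⟩
    rw [Real.dist_eq]
    have h1 : t - ⌊t / m.2⌋ * m.2 = Int.fract (t / m.2) * m.2 := by
      rw [← Int.self_sub_floor]
      field_simp
    rw [h1, abs_mul, abs_of_nonneg (Int.fract_nonneg _)]
    exact (mul_le_of_le_one_left (abs_nonneg _) (Int.fract_lt_one _).le).trans_lt hmlt
  rwa [hcl.closure_eq] at this

/-- An unstable half-line is contained in every bracket closed invariant set that contains a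
nontrivial fine chain through the origin. -/
theorem unstable_ray_mem (hSc : IsClosed S) (hS : ∀ n w, E.D n w ∈ S ↔ w ∈ S) (hδ : 0 < δ)
    (hper : ∀ w m, E.q m = 0 → w ∈ S → w + m ∈ S)
    (hbr : BracketClosed S δ) (hLS : L ⊆ S) (hLc : IsClosed L) (hL0 : 0 ∈ L)
    (hL : ∀ n w, E.D n w ∈ L ↔ w ∈ L) {y : StableUnstable} (hy : FinelyReach L y)
    (hy0 : y ≠ 0) :
    (∀ t : ℝ, 0 ≤ t → (((0, 0), t) : StableUnstable) ∈ S) ∨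
      ∀ t : ℝ, t ≤ 0 → (((0, 0), t) : StableUnstable) ∈ S := by
  by_cases hst : ∀ y, FinelyReach L y → y.2 = 0
  · exact Or.inl fun t _ => unstable_line_mem E hSc hS hδ hper hbr hLS hLc hL0 hL hst hy hy0 t
  · push Not at hst
    obtain ⟨z, hz, hz0⟩ := hst
    exact unstable_ray_mem_of_segment E hS hz0
      (unstable_segment_mem E hSc hS hδ hbr hLS hL0 hz)

end Product

/-! ### Continua, brackets on the torus and part (a). -/

section ProductStructure

variable {f : T3 ≃ₜ T3} (E : DiagonalCover f)

/-- A continuum with more than one point contains nontrivial fine chains. -/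
theorem exists_finelyReach_ne_zero {Λ : Set T3} (hc : IsClosed Λ) (hconn : IsPreconnected Λ)
    (hnt : Λ.Nontrivial) {x₀ : T3} (hx₀ : x₀ ∈ Λ) :
    ∃ y ≠ 0, FinelyReach {w | x₀ + E.q w ∈ Λ} y := by
  set L := {w | x₀ + E.q w ∈ Λ} with hLdef
  have hK := E.K_pos
  have hLc : IsClosed L := hc.preimage (continuous_const.add E.continuous_q)
  have hL0 : (0 : StableUnstable) ∈ L := by simpa [hLdef] using hx₀
  obtain ⟨z, hz, hzx⟩ := hnt.exists_ne x₀
  -- No vector of norm below `R` projects to `z`, so a chain confined to a smaller ball never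
  -- reaches it.
  set R := dist z x₀ / E.K with hRdef
  have hR : 0 < R := div_pos (dist_pos.2 hzx) hK
  have hfar : ∀ w, ‖w‖ < R → x₀ + E.q w ≠ z := by
    intro w hw h
    have h1 : dist z x₀ ≤ E.K * ‖w‖ := by
      rw [← h, dist_eq_norm, add_sub_cancel_left]
      exact E.norm_q_le w
    have h2 : E.K * ‖w‖ < dist z x₀ := by
      rwa [hRdef, lt_div_iff₀' hK] at hw
    linarith
  have hexit : ∀ η > 0, ∃ w ∈ {w : StableUnstable | R / 2 ≤ ‖w‖}, Reach L η R w := by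
    intro η hη
    -- Steps below `R / 2` from the half ball stay in the ball of radius `R`.
    suffices h : ∃ w ∈ {w : StableUnstable | R / 2 ≤ ‖w‖}, Reach L (min η (R / 2)) R w from
      h.imp fun w hw => ⟨hw.1, hw.2.mono (min_le_left _ _)⟩
    set ζ := min η (R / 2)
    have hζ : 0 < ζ := lt_min hη (half_pos hR)
    by_contra! hcon
    have hlt : ∀ w, Reach L ζ R w → ‖w‖ < R / 2 := by
      intro w hw
      by_contra h
      exact hcon w (not_lt.1 h) hw
    set T := {x | ∃ w, Reach L ζ R w ∧ x₀ + E.q w = x} with hT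
    -- If no chain leaves the half ball, every point of `Λ` near `T` can be appended to a chain.
    -- Then `T` and `Λ \ T` are at positive distance, with `x₀` in one and `z` in the other, against
    -- connectedness.
    have hgrow : ∀ t ∈ T, ∀ x ∈ Λ, dist t x < ζ / E.K → x ∈ T := by
      rintro _ ⟨w, hw, rfl⟩ x hx hd
      obtain ⟨v, hv, hvw⟩ := E.exists_lift_near w (x - x₀)
      have h1 : dist (x - x₀) (E.q w) < ζ / E.K := by
        rw [dist_comm, dist_eq_norm] at hd
        rw [dist_eq_norm]
        convert hd using 2
        abel
      have h2 : ‖v - w‖ < ζ := hvw.trans_lt (by rwa [← lt_div_iff₀' hK])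
      have h3 : x₀ + E.q v = x := by rw [hv]; abel
      refine ⟨v, Relation.ReflTransGen.tail hw ⟨?_, ?_, h2⟩, h3⟩
      · change x₀ + E.q v ∈ Λ
        rwa [h3]
      · have h4 := norm_le_norm_add_norm_sub w v
        rw [norm_sub_rev] at h4
        have h5 := hlt w hw
        have h6 : ζ ≤ R / 2 := min_le_right _ _
        linarith
    have hζK : 0 < ζ / E.K / 2 := by positivity
    obtain ⟨p, -, hp⟩ := hconn (⋃ t ∈ T, Metric.ball t (ζ / E.K / 2))
      (⋃ x ∈ Λ \ T, Metric.ball x (ζ / E.K / 2))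
      (isOpen_biUnion fun _ _ => Metric.isOpen_ball)
      (isOpen_biUnion fun _ _ => Metric.isOpen_ball)
      (by
        intro x hx
        by_cases hxT : x ∈ T
        · exact Or.inl (mem_biUnion hxT (Metric.mem_ball_self hζK))
        · exact Or.inr (mem_biUnion (show x ∈ Λ \ T from ⟨hx, hxT⟩) (Metric.mem_ball_self hζK)))
      ⟨x₀, hx₀, mem_biUnion (show x₀ ∈ T from ⟨0, Relation.ReflTransGen.refl, by simp⟩)
        (Metric.mem_ball_self hζK)⟩
      ⟨z, hz, mem_biUnion (show z ∈ Λ \ T from ⟨hz, by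
          rintro ⟨w, hw, hwz⟩
          exact hfar w ((hlt w hw).trans (by linarith)) hwz⟩) (Metric.mem_ball_self hζK)⟩
    simp only [mem_inter_iff, mem_iUnion, exists_prop, Metric.mem_ball] at hp
    obtain ⟨⟨t, ht, hpt⟩, x, hx, hpx⟩ := hp
    refine hx.2 (hgrow t ht x hx.1 ?_)
    have := dist_triangle_left t x p
    linarith
  obtain ⟨y, hy, hyR⟩ := exists_finely_reached (isClosed_le continuous_const continuous_norm)
    hLc hL0 hR.le hexit
  refine ⟨y, ?_, R, hR.le, hyR⟩
  rintro rfl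
  simp only [mem_ofPred_eq, norm_zero] at hy
  linarith

/-- The bracket differs from `v` by a stable vector and from `w` by an unstable one, and neither
grows in the relevant time direction. -/
theorem bracket_mem (x₀ : T3) {v w : StableUnstable} {ε : ℝ} (hvw : E.K * ‖v - w‖ < ε) :
    x₀ + E.q (w.1, v.2) ∈ localStable f ε (x₀ + E.q v) ∩ localUnstable f ε (x₀ + E.q w) := by
  have hK := E.K_pos
  have hiter : ∀ (n : ℤ) (u u' : StableUnstable), ‖E.D n (u - u')‖ ≤ ‖v - w‖ →
      dist ((f ^ n) (x₀ + E.q u)) ((f ^ n) (x₀ + E.q u')) < ε := by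
    intro n u u' hu
    rw [E.zpow_add_apply, E.zpow_add_apply, dist_add_left, E.zpow_q, E.zpow_q]
    refine (E.dist_q_le _ _).trans_lt (lt_of_le_of_lt ?_ hvw)
    rw [← map_sub]
    gcongr
  refine ⟨fun n => hiter _ _ _ ?_, fun n => hiter _ _ _ ?_⟩
  · refine max_le ?_ ?_
    · refine (norm_D_fst_le E n _).trans ?_
      refine (mul_le_of_le_one_left (norm_nonneg _)
        (pow_le_one₀ E.b_pos.le E.b_lt_one.le)).trans ?_
      refine max_le ?_ ?_
      · exact norm_fst_le (v - w)
      · simp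
    · simp
  · refine max_le ?_ ?_
    · refine le_trans (le_of_eq ?_) (norm_nonneg _)
      rw [norm_eq_zero]
      refine Prod.ext ?_ ?_ <;> simp
    · have hc := pow_pos E.c_pos n
      rw [DiagonalCover.D_snd, norm_mul, zpow_neg, zpow_natCast,
        Real.norm_of_nonneg (inv_pos.2 hc).le]
      refine (mul_le_of_le_one_left (norm_nonneg _)
        (inv_le_one_of_one_le₀ (one_le_pow₀ E.one_lt_c.le))).trans ?_
      rw [norm_sub_rev]
      exact norm_snd_le (w - v)

/-- The linear bracket lies in the intersection of the local manifolds, so uniqueness identifies it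
with the point known to be in `Δ`. -/
theorem bracketClosed_of_hasLocalProductStructure {Δ : Set T3}
    (h : HasLocalProductStructure f Δ) (x₀ : T3) :
    ∃ δ > 0, BracketClosed {w | x₀ + E.q w ∈ Δ} δ := by
  obtain ⟨ε, hε, δ, hδ, h⟩ := h
  have hK := E.K_pos
  refine ⟨min ε δ / E.K, by positivity, fun v hv w hw hvw => ?_⟩
  rw [lt_div_iff₀' hK] at hvw
  have hd : dist (x₀ + E.q v) (x₀ + E.q w) < δ := by
    rw [dist_add_left]
    exact (E.dist_q_le v w).trans_lt (hvw.trans_le (min_le_right _ _))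
  obtain ⟨z, hz, hzeq⟩ := h _ hv _ hw hd
  have hmem := bracket_mem E x₀ (hvw.trans_le (min_le_left _ _))
  rw [hzeq, mem_singleton_iff] at hmem
  change x₀ + E.q (w.1, v.2) ∈ Δ
  rwa [hmem]

/-- By recurrence, a closed set that contains an unstable half-line contains the whole line. -/
theorem unstable_line_mem_of_ray {Δ : Set T3} (hΔ : IsClosed Δ) {x₀ : T3} {s : ℝ} (hs : s ≠ 0)
    (h : ∀ t : ℝ, 0 ≤ t / s → x₀ + E.q ((0, 0), t) ∈ Δ) (t : ℝ) :
    x₀ + E.q ((0, 0), t) ∈ Δ := by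
  -- One step of length `κ * |s|` already moves the parameter `t` onto the half-line. Differences
  -- along a convergent subsequence of multiples of this step tend to `0` on the torus, so the point
  -- at `t` is a limit of points of the half-line.
  obtain ⟨κ, hκ, hκt⟩ : ∃ κ : ℝ, 0 < κ ∧ |t / s| ≤ κ := ⟨|t / s| + 1, by positivity, by linarith⟩
  obtain ⟨x, -, φ, hφ, hlim⟩ := isCompact_univ.tendsto_subseq
    (x := fun n : ℕ => E.q ((0, 0), n * (κ * s))) (fun n => mem_univ _)
  have h1 : Tendsto (fun k => x₀ + (E.q ((0, 0), t) + (E.q ((0, 0), φ (k + 1) * (κ * s)) -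
      E.q ((0, 0), φ k * (κ * s))))) atTop (𝓝 (x₀ + (E.q ((0, 0), t) + (x - x)))) :=
    tendsto_const_nhds.add (tendsto_const_nhds.add
      ((hlim.comp (tendsto_add_atTop_nat 1)).sub hlim))
  rw [sub_self, add_zero] at h1
  refine hΔ.mem_of_tendsto h1 (Eventually.of_forall fun k => ?_)
  rw [← map_sub, ← map_add]
  have h2 : (((0, 0), t) + (((0, 0), φ (k + 1) * (κ * s)) - ((0, 0), φ k * (κ * s))) :
      StableUnstable) = ((0, 0), t + (φ (k + 1) - φ k) * (κ * s)) := by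
    refine Prod.ext (Prod.ext ?_ ?_) ?_
    · simp
    · simp
    · simp only [Prod.snd_add, Prod.snd_sub]
      ring
  rw [h2]
  apply h
  have h3 : (1 : ℝ) ≤ φ (k + 1) - φ k := by
    have : φ k + 1 ≤ φ (k + 1) := hφ (Nat.lt_succ_self k)
    have h4 : ((φ k + 1 : ℕ) : ℝ) ≤ φ (k + 1) := by exact_mod_cast this
    push_cast at h4
    linarith
  have h5 : (t + (φ (k + 1) - φ k) * (κ * s)) / s = t / s + (φ (k + 1) - φ k) * κ := by
    field_simp
  rw [h5]
  have := neg_abs_le (t / s)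
  nlinarith

/-- An invariant set with local product structure that contains a nontrivial continuum through a
fixed point, itself invariant, is the whole torus. -/
theorem DiagonalCover.eq_univ_of_hasLocalProductStructure (E : DiagonalCover f)
    {Λ Δ : Set T3} (hΛc : IsClosed Λ)
    (hconn : IsPreconnected Λ) (hΛ : f '' Λ = Λ) (hnt : Λ.Nontrivial) {x₀ : T3} (hx₀ : x₀ ∈ Λ)
    (hfix : f x₀ = x₀) (hΛΔ : Λ ⊆ Δ) (hΔc : IsClosed Δ) (hΔ : f '' Δ = Δ)
    (hlps : HasLocalProductStructure f Δ) : Δ = univ := by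
  have hfixn : ∀ n : ℤ, (f ^ n) x₀ = x₀ := fun n =>
    (zpow_mem_iff (s := {x₀}) (by simp [hfix]) n x₀).2 rfl
  have hinv : ∀ s : Set T3, f '' s = s → ∀ (n : ℤ) w,
      E.D n w ∈ {w | x₀ + E.q w ∈ s} ↔ w ∈ {w | x₀ + E.q w ∈ s} := by
    intro s hs n w
    change x₀ + E.q (E.D n w) ∈ s ↔ x₀ + E.q w ∈ s
    rw [← zpow_mem_iff hs n (x₀ + E.q w), E.zpow_add_apply, hfixn, E.zpow_q]
  obtain ⟨y, hy0, hy⟩ := exists_finelyReach_ne_zero E hΛc hconn hnt hx₀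
  obtain ⟨δ, hδ, hbr⟩ := bracketClosed_of_hasLocalProductStructure E hlps x₀
  have hray := unstable_ray_mem E (hΔc.preimage (continuous_const.add E.continuous_q))
    (hinv Δ hΔ) hδ
    (fun w m hm hw => by
      change x₀ + E.q (w + m) ∈ Δ
      rw [_root_.map_add, hm, add_zero]
      exact hw)
    hbr (fun w hw => hΛΔ hw) (hΛc.preimage (continuous_const.add E.continuous_q))
    (show x₀ + E.q 0 ∈ Λ by rwa [map_zero, add_zero]) (hinv Λ hΛ) hy hy0
  have hline : ∀ t : ℝ, x₀ + E.q ((0, 0), t) ∈ Δ := by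
    rcases hray with h | h
    · exact unstable_line_mem_of_ray E hΔc one_ne_zero fun t ht => h t (by simpa using ht)
    · exact unstable_line_mem_of_ray E hΔc (neg_ne_zero.2 one_ne_zero)
        fun t ht => h t (by rwa [div_neg, div_one, neg_nonneg] at ht)
  refine eq_univ_of_forall fun x => ?_
  have h1 := E.dense_unstable_line (x - x₀)
  have h2 : IsClosed {z | x₀ + z ∈ Δ} := hΔc.preimage (by fun_prop)
  have h3 : x - x₀ ∈ {z | x₀ + z ∈ Δ} := by
    refine h2.closure_subset_iff.2 ?_ h1
    rintro _ ⟨t, rfl⟩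
    exact hline t
  simpa using h3

/-! ### Expansivity and the local product structure of the torus -/

theorem snd_eq_zero_of_norm_D_le {v : StableUnstable} {B : ℝ} (h : ∀ n : ℕ, ‖E.D n v‖ ≤ B) :
    v.2 = 0 := by
  by_contra hv
  obtain ⟨n, hn⟩ := pow_unbounded_of_one_lt (B / |v.2|) E.one_lt_c
  rw [div_lt_iff₀ (abs_pos.2 hv)] at hn
  have h1 := (norm_snd_le _).trans (h n)
  rw [DiagonalCover.D_snd, norm_mul, zpow_natCast, Real.norm_of_nonneg (pow_pos E.c_pos n).le,
    Real.norm_eq_abs] at h1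
  linarith

theorem fst_eq_zero_of_norm_D_le {v : StableUnstable} {B : ℝ}
    (h : ∀ n : ℕ, ‖E.D (-(n : ℤ)) v‖ ≤ B) : v.1 = 0 := by
  have key : ∀ l x : ℝ, 0 < l → l < 1 → (∀ n : ℕ, ‖l ^ (-(n : ℤ)) * x‖ ≤ B) → x = 0 := by
    intro l x h0 h1 hb
    by_contra hx
    obtain ⟨n, hn⟩ := pow_unbounded_of_one_lt (B / |x|) (one_lt_inv_iff₀.2 ⟨h0, h1⟩)
    rw [div_lt_iff₀ (abs_pos.2 hx)] at hn
    have h2 := hb n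
    rw [norm_mul, zpow_neg, zpow_natCast, ← inv_pow,
      Real.norm_of_nonneg (pow_pos (inv_pos.2 h0) n).le, Real.norm_eq_abs] at h2
    linarith
  refine Prod.ext (key E.a _ E.a_pos E.a_lt_one fun n => ?_)
    (key E.b _ E.b_pos E.b_lt_one fun n => ?_)
  · exact ((norm_fst_le _).trans (norm_fst_le _)).trans (h n)
  · exact ((norm_snd_le _).trans (norm_fst_le _)).trans (h n)

/-- A displacement whose image stays small under iteration of a power `s = ±1` of `f` lifts to a
vector that stays small. -/
theorem norm_D_le_of_norm_q_le {s : ℤ} {M ε : ℝ} (hM : ∀ w, ‖E.D s w‖ ≤ M * ‖w‖)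
    (hε : E.K * ((M + 1) * (E.K * ε)) < 1) {v : StableUnstable} (hv : ‖v‖ ≤ E.K * ε)
    (h : ∀ n : ℕ, ‖E.q (E.D (s * n) v)‖ ≤ ε) (hM0 : 0 ≤ M) (n : ℕ) :
    ‖E.D (s * n) v‖ ≤ E.K * ε := by
  have hK := E.K_pos
  induction n with
  | zero => simpa [E.D_zero] using hv
  | succ n ih =>
    obtain ⟨u, hu, hun⟩ := E.exists_lift (E.q (E.D (s * (n + 1 : ℕ)) v))
    have hun' : ‖u‖ ≤ E.K * ε := hun.trans (by gcongr; exact h (n + 1))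
    have hD : E.D (s * (n + 1 : ℕ)) v = E.D s (E.D (s * n) v) := by
      rw [← E.D_add]
      congr 2
      push_cast
      ring
    -- The iterate and the short lift `u` differ by a period of norm at most `(M + 1) * (K * ε)`,
    -- which is too short to be nonzero.
    have h0 : E.D (s * (n + 1 : ℕ)) v - u = 0 := by
      refine E.eq_zero_of_q_eq_zero (by rw [map_sub, hu, sub_self]) (lt_of_le_of_lt ?_ hε)
      gcongr
      refine (norm_sub_le _ _).trans ?_
      rw [hD]
      have h1 := hM (E.D (s * n) v)
      have h2 : M * ‖E.D (s * n) v‖ ≤ M * (E.K * ε) := by gcongr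
      linarith
    rw [sub_eq_zero.1 h0]
    exact hun'

/-- The two local manifolds of nearby points of the torus meet in exactly one point. -/
theorem DiagonalCover.exists_localProduct (E : DiagonalCover f) :
    ∃ ε₀ > 0, ∀ ε > 0, ε ≤ ε₀ → ∃ δ > 0, ∀ x y : T3, dist x y < δ →
    ∃ z, localStable f ε x ∩ localUnstable f ε y = {z} := by
  have hK := E.K_pos
  obtain ⟨M₁, hM₁, hD₁⟩ := E.norm_D_le 1
  obtain ⟨M₂, hM₂, hD₂⟩ := E.norm_D_le (-1)
  -- Large enough to dominate `M₁ + 1` and `M₂ + 1`, needed for tracking lifts, and the `3` from the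
  -- comparison of `p` with `r`.
  set M := M₁ + M₂ + 3 with hM
  refine ⟨1 / (2 * E.K * (M * E.K)), by positivity, fun ε hε hε₀ => ?_⟩
  have hsmall : E.K * (M * (E.K * ε)) < 1 := by
    rw [le_div_iff₀ (by positivity)] at hε₀
    nlinarith [hε₀]
  refine ⟨ε / (E.K + 1) / (E.K + 1), by positivity, fun x y hxy => ?_⟩
  have hδ1 : E.K * (E.K * dist x y) < ε := by
    rw [lt_div_iff₀ (by positivity), lt_div_iff₀ (by positivity)] at hxy
    have := dist_nonneg (x := x) (y := y)
    nlinarith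
  obtain ⟨v, rfl, -⟩ := E.exists_lift x
  obtain ⟨w, rfl, hwv⟩ := E.exists_lift_near v y
  rw [dist_comm] at hwv
  have hwv' : E.K * ‖w - v‖ < ε := lt_of_le_of_lt (by gcongr) hδ1
  have hδ2 : ‖w - v‖ < E.K * ε := by
    rw [lt_div_iff₀ (by positivity), lt_div_iff₀ (by positivity)] at hxy
    have h1 := dist_nonneg (x := E.q v) (y := E.q w)
    refine lt_of_le_of_lt hwv ?_
    gcongr
    have h2 : 0 ≤ dist (E.q v) (E.q w) * (E.K * (E.K + 2)) := by positivity
    linarith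
  refine ⟨E.q (w.1, v.2), Subset.antisymm ?_ ?_⟩
  · rintro z ⟨hzs, hzu⟩
    -- Uniqueness: `p - v` stays bounded in the future, hence is stable, while `r - w` stays bounded
    -- in the past, hence is unstable. The two lifts of `z` are close, so they coincide and are the
    -- bracket.
    obtain ⟨p, hp, hpv⟩ := E.exists_lift_near v z
    obtain ⟨r, hr, hrw⟩ := E.exists_lift_near w z
    have hs0 := hzs 0
    have hu0 := hzu 0
    simp only [Nat.cast_zero, neg_zero, zpow_zero, Homeomorph.one_apply] at hs0 hu0
    have hpv' : ‖p - v‖ ≤ E.K * ε := hpv.trans (by gcongr; rw [dist_comm]; exact hs0.le)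
    have hrw' : ‖r - w‖ ≤ E.K * ε := hrw.trans (by gcongr; rw [dist_comm]; exact hu0.le)
    have hKε : 0 < E.K * ε := by positivity
    have hpv2 : (p - v).2 = 0 := by
      refine snd_eq_zero_of_norm_D_le E (B := E.K * ε) fun n => ?_
      have := norm_D_le_of_norm_q_le E hD₁ (ε := ε) (lt_of_le_of_lt ?_ hsmall) hpv'
        (fun n => ?_) hM₁.le n
      · simpa using this
      · gcongr
        linarith
      · rw [one_mul, map_sub, map_sub, ← E.zpow_q, ← E.zpow_q, hp, ← dist_eq_norm, dist_comm]
        exact (hzs n).le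
    have hrw1 : (r - w).1 = 0 := by
      refine fst_eq_zero_of_norm_D_le E (B := E.K * ε) fun n => ?_
      have := norm_D_le_of_norm_q_le E hD₂ (ε := ε) (lt_of_le_of_lt ?_ hsmall) hrw'
        (fun n => ?_) hM₂.le n
      · simpa using this
      · gcongr
        linarith
      · rw [neg_one_mul, map_sub, map_sub, ← E.zpow_q, ← E.zpow_q, hr, ← dist_eq_norm, dist_comm]
        exact (hzu n).le
    have hpr : p - r = 0 := by
      refine E.eq_zero_of_q_eq_zero (by rw [map_sub, hp, hr, sub_self])
        (lt_of_le_of_lt ?_ hsmall)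
      have h1 : p - r = (p - v) - (r - w) - (w - v) := by abel
      have h2 : ‖p - r‖ ≤ 3 * (E.K * ε) := by
        rw [h1]
        refine (norm_sub_le _ _).trans ?_
        have := norm_sub_le (p - v) (r - w)
        linarith
      gcongr
      refine h2.trans ?_
      gcongr
      linarith
    rw [sub_eq_zero] at hpr
    rw [mem_singleton_iff, ← hp]
    congr 1
    refine Prod.ext ?_ ?_
    · rw [hpr]
      exact sub_eq_zero.1 hrw1
    · exact sub_eq_zero.1 hpv2
  · rintro _ rfl
    have := bracket_mem E 0 (v := v) (w := w) (ε := ε) (by rwa [norm_sub_rev])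
    simpa only [zero_add] using this

theorem DiagonalCover.hasLocalProductStructure_univ (E : DiagonalCover f) :
    HasLocalProductStructure f univ := by
  obtain ⟨ε, hε, h⟩ := E.exists_localProduct
  obtain ⟨δ, hδ, h⟩ := h ε hε le_rfl
  exact ⟨ε, hε, δ, hδ, fun x _ y _ hxy => (h x y hxy).imp fun z hz => ⟨mem_univ _, hz⟩⟩

/-- The intersection point follows the orbit of `x` in the future and that of `y` in the past, so
its whole orbit stays in `V` once the size of the local manifolds is at most the radius of a
thickening inside `V`. -/
theorem DiagonalCover.hasLocalProductStructure_of_isLocallyMaximal (E : DiagonalCover f)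
    {Δ : Set T3} (hc : IsCompact Δ) (hΔ : f '' Δ = Δ) (hmax : IsLocallyMaximal f Δ) :
    HasLocalProductStructure f Δ := by
  obtain ⟨V, hV, hVΔ⟩ := hmax
  obtain ⟨r, hr, hrV⟩ := hc.exists_thickening_subset_open isOpen_interior
    (subset_interior_iff_mem_nhdsSet.2 hV)
  obtain ⟨ε₀, hε₀, h⟩ := E.exists_localProduct
  obtain ⟨δ, hδ, h⟩ := h (min ε₀ r) (lt_min hε₀ hr) (min_le_left _ _)
  refine ⟨min ε₀ r, lt_min hε₀ hr, δ, hδ, fun x hx y hy hxy => ?_⟩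
  obtain ⟨z, hz⟩ := h x y hxy
  refine ⟨z, ?_, hz⟩
  obtain ⟨hzs, hzu⟩ : z ∈ localStable f (min ε₀ r) x ∩ localUnstable f (min ε₀ r) y := by
    rw [hz]
    rfl
  have hnear : ∀ (n : ℤ) (p : T3), p ∈ Δ → dist ((f ^ n) p) ((f ^ n) z) < min ε₀ r →
      (f ^ n) z ∈ V := by
    intro n p hp hd
    refine interior_subset (hrV (Metric.mem_thickening_iff.2
      ⟨(f ^ n) p, (zpow_mem_iff hΔ n p).2 hp, ?_⟩))
    rw [dist_comm]
    exact hd.trans_le (min_le_right _ _)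
  rw [hVΔ, mem_iInter]
  intro n
  have hmem : (f ^ (-n)) z ∈ V := by
    obtain ⟨k, hk | hk⟩ := (-n).eq_nat_or_neg
    · rw [hk]
      exact hnear _ x hx (hzs k)
    · rw [hk]
      exact hnear _ y hy (hzu k)
  exact ⟨_, hmem, ((homeomorph_zpow_neg_apply_eq_iff f n z _).1 rfl).symm⟩

theorem isLocallyMaximal_univ {X : Type*} [MetricSpace X] (f : X ≃ₜ X) :
    IsLocallyMaximal f univ := by
  refine ⟨univ, Filter.univ_mem, ?_⟩
  simp [Set.range_eq_univ.2 (Homeomorph.surjective _)]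

end ProductStructure

/-! ### Hyperbolicity of compact invariant sets. -/

namespace DiagonalCover

variable {f : T3 ≃ₜ T3} (E : DiagonalCover f)

/-- The derivative of the `n`-th iterate. -/
noncomputable def deriv (n : ℤ) : E3 →L[ℝ] E3 :=
  (E.J.symm : StableUnstable →L[ℝ] E3) ∘L
    LinearMap.toContinuousLinearMap
      { toFun := E.D n
        map_add' := _root_.map_add _
        map_smul' := by
          intro r w
          refine Prod.ext (Prod.ext ?_ ?_) ?_ <;> simp [mul_left_comm] } ∘L
    (E.J : E3 →L[ℝ] StableUnstable)

theorem deriv_apply (n : ℤ) (v : E3) : E.deriv n v = E.J.symm (E.D n (E.J v)) := rfl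

theorem hasTorusFDerivAt (n : ℤ) (x : T3) :
    HasTorusFDerivAt (f ^ n : T3 ≃ₜ T3) (E.deriv n) x := by
  refine ⟨E.deriv n, map_zero _, (E.deriv n).hasFDerivAt, Eventually.of_forall fun v => ?_⟩
  rw [E.zpow_add_apply]
  congr 1
  have := E.zpow_q n (E.J v)
  change (f ^ n) (torusProj (E.J.symm (E.J v))) = _ at this
  rw [E.J.symm_apply_apply] at this
  exact this

/-- The derivative does not depend on the base point, so the splitting into eigenspaces is constant;
changing coordinates only affects the constant `C`. -/
theorem isHyperbolicSet (E : DiagonalCover f) {Λ : Set T3} (hc : IsCompact Λ) (hΛ : f '' Λ = Λ) :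
    IsHyperbolicSet f Λ := by
  set Es : Submodule ℝ E3 :=
    LinearMap.ker (LinearMap.snd ℝ (ℝ × ℝ) ℝ ∘ₗ (E.J : E3 →ₗ[ℝ] StableUnstable)) with hEs
  set Eu : Submodule ℝ E3 :=
    LinearMap.ker (LinearMap.fst ℝ (ℝ × ℝ) ℝ ∘ₗ (E.J : E3 →ₗ[ℝ] StableUnstable)) with hEu
  have hmemS : ∀ v, v ∈ Es ↔ (E.J v).2 = 0 := fun v => Iff.rfl
  have hmemU : ∀ v, v ∈ Eu ↔ (E.J v).1 = 0 := fun v => Iff.rfl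
  have hinv : ∀ n : ℤ, ∀ v, E.deriv n (E.deriv (-n) v) = v := by
    intro n v
    rw [deriv_apply, deriv_apply, E.J.apply_symm_apply, E.D_D_neg, E.J.symm_apply_apply]
  have hS : ∀ n : ℤ, ∀ v ∈ Es, E.deriv n v ∈ Es := by
    intro n v hv
    rw [hmemS] at hv ⊢
    rw [deriv_apply, E.J.apply_symm_apply, D_snd, hv, mul_zero]
  have hU : ∀ n : ℤ, ∀ v ∈ Eu, E.deriv n v ∈ Eu := by
    intro n v hv
    rw [hmemU] at hv ⊢
    rw [deriv_apply, E.J.apply_symm_apply]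
    refine Prod.ext ?_ ?_ <;> simp [hv]
  have hmap : ∀ F : Submodule ℝ E3, (∀ n : ℤ, ∀ v ∈ F, E.deriv n v ∈ F) →
      F.map (E.deriv 1 : E3 →ₗ[ℝ] E3) = F := by
    intro F hF
    refine le_antisymm ?_ fun v hv => ⟨E.deriv (-1) v, hF _ v hv, hinv 1 v⟩
    rintro _ ⟨v, hv, rfl⟩
    exact hF 1 v hv
  have hcompl : IsCompl Es Eu := by
    constructor
    · rw [Submodule.disjoint_def]
      intro v hs hu
      have : E.J v = 0 := Prod.ext hu hs
      simpa using this
    · rw [Submodule.codisjoint_iff_exists_add_eq]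
      intro v
      refine ⟨E.J.symm ((E.J v).1, 0), E.J.symm (0, (E.J v).2), ?_, ?_, ?_⟩
      · rw [hmemS, E.J.apply_symm_apply]
      · rw [hmemU, E.J.apply_symm_apply]
      · rw [← _root_.map_add]
        simp
  set C := ‖(E.J.symm : StableUnstable →L[ℝ] E3)‖ * ‖(E.J : E3 →L[ℝ] StableUnstable)‖ + 1
  set l := max E.b E.c⁻¹
  have hl0 : 0 < l := lt_max_of_lt_left E.b_pos
  have hbound : ∀ (n : ℤ) (k : ℕ) (v : E3), ‖E.D n (E.J v)‖ ≤ l ^ k * ‖E.J v‖ →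
      ‖E.deriv n v‖ ≤ C * l ^ k * ‖v‖ := by
    intro n k v h
    have h1 := (E.J.symm : StableUnstable →L[ℝ] E3).le_opNorm (E.D n (E.J v))
    have h2 := (E.J : E3 →L[ℝ] StableUnstable).le_opNorm v
    have hk := pow_pos hl0 k
    calc ‖E.deriv n v‖ ≤ ‖(E.J.symm : StableUnstable →L[ℝ] E3)‖ * ‖E.D n (E.J v)‖ := h1
      _ ≤ ‖(E.J.symm : StableUnstable →L[ℝ] E3)‖ * (l ^ k *
          (‖(E.J : E3 →L[ℝ] StableUnstable)‖ * ‖v‖)) := by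
        gcongr
        refine h.trans ?_
        gcongr
        exact h2
      _ ≤ C * l ^ k * ‖v‖ := by
        have : 0 ≤ l ^ k * ‖v‖ := by positivity
        linarith
  refine ⟨hc, hΛ, fun n _ => E.deriv n, fun n x _ => E.hasTorusFDerivAt n x, fun _ => Es,
    fun _ => Eu, fun x _ => ⟨hcompl, hmap Es hS, hmap Eu hU⟩, C, by positivity, l,
    ⟨hl0, max_lt E.b_lt_one (inv_lt_one_of_one_lt₀ E.one_lt_c)⟩, fun x _ n =>
    ⟨fun v hv => hbound _ _ _ ?_, fun v hv => hbound _ _ _ ?_⟩⟩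
  · rw [hmemS] at hv
    have hb : E.b ^ n ≤ l ^ n := pow_le_pow_left₀ E.b_pos.le (le_max_left _ _) n
    refine max_le ((norm_D_fst_le E n _).trans (by gcongr)) ?_
    rw [D_snd, hv, mul_zero, norm_zero]
    positivity
  · rw [hmemU] at hv
    have hcn := pow_pos E.c_pos n
    have hb : (E.c⁻¹) ^ n ≤ l ^ n :=
      pow_le_pow_left₀ (inv_nonneg.2 E.c_pos.le) (le_max_right _ _) n
    refine max_le ?_ ?_
    · have : (E.D (-(n : ℤ)) (E.J v)).1 = 0 := by
        refine Prod.ext ?_ ?_ <;> simp [hv]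
      rw [this, norm_zero]
      positivity
    · rw [D_snd, zpow_neg, zpow_natCast, ← inv_pow, norm_mul,
        Real.norm_of_nonneg (pow_pos (inv_pos.2 E.c_pos) n).le]
      gcongr
      exact norm_snd_le _

end DiagonalCover

/-! ### A curve avoiding the contracted copies of a sparse set -/

/-- Admissible functions for the avoidance construction. -/
def IsFlat (g : ℝ → ℝ) : Prop := g 0 = 0 ∧ ∀ x y, |g x - g y| ≤ |x - y| / 6

/-- A flat curve can be pushed away from a sparse set by a small flat perturbation. -/
theorem exists_avoiding_perturbation {r : ℝ} (hr : 0 < r) {P : Set (ℝ × ℝ)}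
    (hP0 : ∀ p ∈ P, 120 * r ≤ ‖p‖) (hP : ∀ p ∈ P, ∀ p' ∈ P, p ≠ p' → 120 * r ≤ ‖p - p'‖)
    {g : ℝ → ℝ} (hg : IsFlat g) :
    ∃ ψ : ℝ → ℝ, IsFlat ψ ∧ (∀ x, |ψ x| ≤ 10 * r) ∧
      ∀ p ∈ P, ∀ x, |x - p.1| ≤ 3 * r → 3 * r ≤ |g x + ψ x - p.2| := by
  obtain ⟨hg0, hgL⟩ := hg
  set Q : Set ℝ := {s | ∃ p ∈ P, |g p.1 - p.2| ≤ 6 * r ∧ p.1 = s} with hQ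
  by_cases hQe : Q = ∅
  · refine ⟨fun _ => 0, ⟨rfl, fun x y => by simp; positivity⟩, fun x => by simp; positivity,
      fun p hp x hx => ?_⟩
    have hfar : 6 * r < |g p.1 - p.2| := by
      by_contra h
      exact (hQe ▸ (⟨p, hp, not_lt.1 h, rfl⟩ : p.1 ∈ Q) : p.1 ∈ (∅ : Set ℝ))
    have h1 := hgL x p.1
    have h2 := abs_sub_le (g p.1) (g x) p.2
    rw [abs_sub_comm (g p.1) (g x)] at h2
    rw [add_zero]
    linarith
  have hne : Q.Nonempty := nonempty_iff_ne_empty.2 hQe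
  set d : ℝ → ℝ := fun x => Metric.infDist x Q with hd
  have hd0 : ∀ x, 0 ≤ d x := fun x => Metric.infDist_nonneg
  have hdL : ∀ x y, |d x - d y| ≤ |x - y| := by
    intro x y
    have := (Metric.lipschitz_infDist_pt Q).dist_le_mul x y
    simpa [Real.dist_eq] using this
  -- Upward bumps of height `10r` and half-width `60r` over the points of `P` that the graph nearly
  -- hits. The separation `120r` ensures that no bump pushes the graph into another point of `P`,
  -- and that the origin is not moved.
  set ψ : ℝ → ℝ := fun x => max 0 (10 * r - d x / 6) with hψ
  have hψ0 : ∀ x, 0 ≤ ψ x := fun x => le_max_left _ _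
  have hψ1 : ∀ x, ψ x ≤ 10 * r := fun x =>
    max_le (by positivity) (by linarith [hd0 x])
  have hψL : ∀ x y, |ψ x - ψ y| ≤ |x - y| / 6 := by
    intro x y
    have h1 : |ψ x - ψ y| ≤ |(10 * r - d x / 6) - (10 * r - d y / 6)| := by
      have := abs_max_sub_max_le_abs (10 * r - d x / 6) (10 * r - d y / 6) 0
      rwa [max_comm _ (0 : ℝ), max_comm _ (0 : ℝ)] at this
    have h2 : (10 * r - d x / 6) - (10 * r - d y / 6) = -((d x - d y) / 6) := by ring
    rw [h2, abs_neg, abs_div, abs_of_pos (by norm_num : (0 : ℝ) < 6)] at h1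
    linarith [hdL x y]
  have hact : ∀ x, 0 < ψ x → ∃ q ∈ P, |g q.1 - q.2| ≤ 6 * r ∧ |x - q.1| < 60 * r := by
    intro x hx
    have h1 : d x < 60 * r := by
      rcases lt_max_iff.1 hx with h | h
      · exact absurd h (lt_irrefl _)
      · linarith
    obtain ⟨s, ⟨q, hq, hqg, rfl⟩, hs⟩ := (Metric.infDist_lt_iff hne).1 h1
    exact ⟨q, hq, hqg, hs⟩
  refine ⟨ψ, ⟨?_, hψL⟩, fun x => by rw [abs_of_nonneg (hψ0 x)]; exact hψ1 x, fun p hp x hx => ?_⟩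
  · by_contra h
    obtain ⟨q, hq, hqg, hq1⟩ := hact 0 (lt_of_le_of_ne (hψ0 0) (Ne.symm h))
    have h1 := hP0 q hq
    have h2 := hgL q.1 0
    rw [hg0, sub_zero, sub_zero] at h2
    rw [zero_sub, abs_neg] at hq1
    have h3 : |q.2| ≤ |q.2 - g q.1| + |g q.1| := by
      simpa using abs_sub_le q.2 (g q.1) 0
    rw [abs_sub_comm] at h3
    have h4 : ‖q‖ < 120 * r := max_lt (by rw [Real.norm_eq_abs]; linarith)
      (by rw [Real.norm_eq_abs]; linarith)
    linarith
  · by_cases hnear : |g p.1 - p.2| ≤ 6 * r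
    · have h1 : d x ≤ 3 * r :=
        (Metric.infDist_le_dist_of_mem (show p.1 ∈ Q from ⟨p, hp, hnear, rfl⟩)).trans hx
      have h2 : 10 * r - d x / 6 ≤ ψ x := le_max_right _ _
      have h3 := abs_le.1 (hgL x p.1)
      have h4 := abs_le.1 hnear
      refine le_trans ?_ (le_abs_self _)
      linarith
    · by_contra hcon
      push Not at hnear hcon
      have h1 := hgL x p.1
      have h0 : 0 < ψ x := by
        refine lt_of_le_of_ne (hψ0 x) fun h => ?_
        rw [← h, add_zero] at hcon
        have h2 := abs_sub_le (g p.1) (g x) p.2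
        rw [abs_sub_comm (g p.1) (g x)] at h2
        linarith
      obtain ⟨q, hq, hqg, hqx⟩ := hact x h0
      have hpq : p ≠ q := by
        rintro rfl
        linarith
      have h2 := hP p hp q hq hpq
      have h3 := hgL x q.1
      have h4 := abs_lt.1 hcon
      have h5 := abs_le.1 hqg
      have h6 := abs_le.1 h3
      have h7 := abs_le.1 hx
      have h8 := abs_lt.1 hqx
      have h9 := hψ1 x
      have : ‖p - q‖ < 120 * r := by
        refine max_lt ?_ ?_
        · change |p.1 - q.1| < _
          rw [abs_lt]
          constructor <;> linarith
        · change |p.2 - q.2| < _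
          rw [abs_lt]
          constructor <;> linarith
      linarith

theorem IsFlat.zero : IsFlat fun _ => 0 := ⟨rfl, fun x y => by simp; positivity⟩

/-- The sum has Lipschitz constant `1/3`, and the anisotropic expansion multiplies slopes by `α / β
≤ 1/2`, restoring `1/6`; this makes the perturbation repeatable. -/
theorem IsFlat.rescale {g ψ : ℝ → ℝ} (hg : IsFlat g) (hψ : IsFlat ψ) {α β : ℝ} (hα : 0 < α)
    (hαβ : 2 * α ≤ β) : IsFlat fun x => β⁻¹ * (g (α * x) + ψ (α * x)) := by
  have hβ : 0 < β := by linarith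
  refine ⟨by simp [hg.1, hψ.1], fun x y => ?_⟩
  rw [← mul_sub, abs_mul, abs_of_pos (inv_pos.2 hβ), inv_mul_le_iff₀ hβ]
  have h1 := hg.2 (α * x) (α * y)
  have h2 := hψ.2 (α * x) (α * y)
  rw [← mul_sub, abs_mul, abs_of_pos hα] at h1 h2
  have h3 : |g (α * x) + ψ (α * x) - (g (α * y) + ψ (α * y))| ≤
      |g (α * x) - g (α * y)| + |ψ (α * x) - ψ (α * y)| := by
    rw [add_sub_add_comm]
    exact abs_add_le _ _
  have := mul_le_mul_of_nonneg_right hαβ (abs_nonneg (x - y))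
  linarith

/-- There is a continuous graph through the origin all of whose expansions avoid neighbourhoods
of a sparse set. -/
theorem exists_avoiding_graph {r : ℝ} (hr : 0 < r) {P : Set (ℝ × ℝ)}
    (hP0 : ∀ p ∈ P, 120 * r ≤ ‖p‖) (hP : ∀ p ∈ P, ∀ p' ∈ P, p ≠ p' → 120 * r ≤ ‖p - p'‖)
    {α β : ℝ} (hα : 0 < α) (hαβ : 2 * α ≤ β) (hβ : 6 * β ≤ 1) :
    ∃ φ : ℝ → ℝ, Continuous φ ∧ φ 0 = 0 ∧ ∀ (n : ℕ) (x : ℝ), ∀ p ∈ P,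
      |(α ^ n)⁻¹ * x - p.1| < r → r ≤ |(β ^ n)⁻¹ * φ x - p.2| := by
  have hβ0 : 0 < β := by linarith
  choose! Ψ hΨf hΨb hΨa using fun (g : ℝ → ℝ) (hg : IsFlat g) =>
    exists_avoiding_perturbation hr hP0 hP hg
  set G : ℕ → ℝ → ℝ := fun n => Nat.rec (fun _ => 0)
    (fun _ g x => β⁻¹ * (g (α * x) + Ψ g (α * x))) n with hG
  have hGs : ∀ n x, G (n + 1) x = β⁻¹ * (G n (α * x) + Ψ (G n) (α * x)) := fun n x => rfl
  have hGf : ∀ n, IsFlat (G n) := by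
    intro n
    induction n with
    | zero => exact IsFlat.zero
    | succ n ih => exact ih.rescale (hΨf _ ih) hα hαβ
  -- `G n` is the graph of `φ n` seen after `n` expansions. The perturbation at stage `n` has size
  -- at most `10 * r * β ^ n` in the original scale, hence uniform convergence.
  set φ : ℕ → ℝ → ℝ := fun n x => β ^ n * G n ((α ^ n)⁻¹ * x) with hφ
  have hφs : ∀ n x, φ (n + 1) x =
      β ^ n * (G n ((α ^ n)⁻¹ * x) + Ψ (G n) ((α ^ n)⁻¹ * x)) := by
    intro n x
    have h1 : α * ((α ^ (n + 1))⁻¹ * x) = (α ^ n)⁻¹ * x := by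
      field_simp
      ring
    simp only [hφ, hGs, h1]
    field_simp
    ring
  have hstep : ∀ x n, dist (φ n x) (φ (n + 1) x) ≤ 10 * r * β ^ n := by
    intro x n
    have hb := pow_pos hβ0 n
    rw [hφs, dist_comm, Real.dist_eq, ← mul_sub, add_sub_cancel_left, abs_mul, abs_of_pos hb,
      mul_comm]
    gcongr
    exact hΨb _ (hGf n) _
  have hβ1 : β < 1 := by linarith
  choose Φ hΦ using fun x =>
    cauchySeq_tendsto_of_complete (cauchySeq_of_le_geometric β (10 * r) hβ1 (hstep x))
  have hdist : ∀ x n, dist (φ n x) (Φ x) ≤ 10 * r * β ^ n / (1 - β) := fun x n =>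
    dist_le_of_le_geometric_of_tendsto β (10 * r) hβ1 (hstep x) (hΦ x) n
  have hcontG : ∀ n, Continuous (G n) := by
    intro n
    have : LipschitzWith 1 (G n) := LipschitzWith.of_dist_le_mul fun x y => by
      have h1 := (hGf n).2 x y
      rw [Real.dist_eq, Real.dist_eq, NNReal.coe_one, one_mul]
      linarith [abs_nonneg (x - y)]
    exact this.continuous
  refine ⟨Φ, ?_, ?_, fun n x p hp hx => ?_⟩
  · have hu : TendstoUniformly φ Φ atTop := by
      rw [Metric.tendstoUniformly_iff]
      intro ε hε
      have h1 : Tendsto (fun n : ℕ => 10 * r * β ^ n / (1 - β)) atTop (𝓝 0) := by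
        have := ((tendsto_pow_atTop_nhds_zero_of_lt_one hβ0.le hβ1).const_mul
          (10 * r)).div_const (1 - β)
        simpa using this
      filter_upwards [h1.eventually_lt_const hε] with n hn x
      rw [dist_comm]
      exact (hdist x n).trans_lt hn
    refine hu.continuous (Frequently.of_forall fun n => ?_)
    have := hcontG n
    fun_prop
  · refine tendsto_nhds_unique (hΦ 0) (tendsto_const_nhds.congr fun n => ?_)
    simp [hφ, (hGf n).1]
  · have hb := pow_pos hβ0 n
    have h1 := hΨa _ (hGf n) p hp ((α ^ n)⁻¹ * x) (by linarith)
    have h2 := hdist x (n + 1)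
    rw [Real.dist_eq, hφs, le_div_iff₀ (by linarith)] at h2
    set u := G n ((α ^ n)⁻¹ * x) + Ψ (G n) ((α ^ n)⁻¹ * x)
    have h3 : β ^ n * |u - (β ^ n)⁻¹ * Φ x| = |β ^ n * u - Φ x| := by
      rw [← abs_of_pos hb, ← abs_mul, abs_of_pos hb]
      congr 1
      field_simp
    rw [← h3, pow_succ] at h2
    -- All later perturbations amount to at most `10rβ / (1 - β) ≤ 2r` at scale `n`, as `β ≤ 1/6`;
    -- of the clearance `3r` there remains `r`.
    have h4 : |u - (β ^ n)⁻¹ * Φ x| ≤ 2 * r := by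
      have h5 : β ^ n * (|u - (β ^ n)⁻¹ * Φ x| * (1 - β)) ≤ β ^ n * (10 * r * β) := by linarith
      have h6 := le_of_mul_le_mul_left h5 hb
      nlinarith [abs_nonneg (u - (β ^ n)⁻¹ * Φ x)]
    have h7 := abs_sub_le u ((β ^ n)⁻¹ * Φ x) p.2
    linarith

/-! ### The avoiding curve on the torus. -/

namespace DiagonalCover

variable {f : T3 ≃ₜ T3}

/-- A graph in the stable plane through the origin whose orbit avoids a ball. -/
theorem exists_curve_avoiding_ball (E : DiagonalCover f) :
    ∃ (φ : ℝ → ℝ) (p : T3), Continuous φ ∧ φ 0 = 0 ∧ ∃ τ > 0, ∃ κ > 0, ∀ n : ℤ, ∀ x ∈ Icc 0 τ,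
      κ ≤ dist ((f ^ n) (E.q ((x, φ x), 0))) p := by
  have hK := E.K_pos
  -- Passing to the `N`-th power gives the contraction ratios that the graph construction requires.
  obtain ⟨N, hNab, hNb⟩ : ∃ N : ℕ, (E.a / E.b) ^ N < 1 / 2 ∧ E.b ^ N < 1 / 6 := by
    have h1 := tendsto_pow_atTop_nhds_zero_of_lt_one (div_pos E.a_pos E.b_pos).le
      ((div_lt_one E.b_pos).2 E.a_lt_b)
    have h2 := tendsto_pow_atTop_nhds_zero_of_lt_one E.b_pos.le E.b_lt_one
    exact ((h1.eventually_lt_const (by norm_num)).and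
      (h2.eventually_lt_const (by norm_num))).exists
  have hN : 0 < N := by
    rcases Nat.eq_zero_or_pos N with rfl | h
    · norm_num at hNb
    · exact h
  -- The forbidden point is the projection of a strong stable vector. Its iterates `z j` are
  -- distinct and nonzero, because a nonzero vector of the stable plane is never a period.
  set e : StableUnstable := ((1, 0), 0) with he
  set z : ℕ → T3 := fun j => E.q (E.D j e) with hz
  have hz0 : ∀ j, z j ≠ 0 := by
    intro j h
    have hne : E.D j e ≠ 0 := by
      intro h0
      have := congrArg (fun w : StableUnstable => w.1.1) h0
      simp [he, E.a_pos.ne'] at this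
    exact (E.coord_ne_zero _ hne h).2.2 (by simp [he])
  have hzi : ∀ i j, i ≠ j → z i - z j ≠ 0 := by
    intro i j hij h
    rw [hz, ← map_sub] at h
    have hne : E.D i e - E.D j e ≠ 0 := by
      intro h0
      have h1 : E.a ^ i - E.a ^ j = 0 := by
        simpa [he] using congrArg (fun w : StableUnstable => w.1.1) h0
      exact hij (pow_right_injective₀ E.a_pos E.a_lt_one.ne (sub_eq_zero.1 h1))
    exact (E.coord_ne_zero _ hne h).2.2 (by simp [he])
  obtain ⟨s, hs, hs0, hsi⟩ : ∃ s : ℝ, 0 < s ∧ (∀ j ∈ Finset.range N, s ≤ ‖z j‖) ∧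
      ∀ i ∈ Finset.range N, ∀ j ∈ Finset.range N, i ≠ j → s ≤ ‖z i - z j‖ := by
    have h1 : ∀ᶠ s : ℝ in 𝓝[>] 0, ∀ j ∈ Finset.range N, s ≤ ‖z j‖ :=
      (Filter.eventually_all_finset _).2 fun j _ =>
        nhdsWithin_le_nhds (Iic_mem_nhds (norm_pos_iff.2 (hz0 j)))
    have h2 : ∀ᶠ s : ℝ in 𝓝[>] 0, ∀ i ∈ Finset.range N, ∀ j ∈ Finset.range N, i ≠ j →
        s ≤ ‖z i - z j‖ :=
      (Filter.eventually_all_finset _).2 fun i _ => (Filter.eventually_all_finset _).2 fun j _ =>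
        Filter.eventually_imp_distrib_left.2 fun hij =>
          nhdsWithin_le_nhds (Iic_mem_nhds (norm_pos_iff.2 (hzi i j hij)))
    have h3 : ∀ᶠ s : ℝ in 𝓝[>] 0, 0 < s := self_mem_nhdsWithin
    exact (h3.and (h1.and h2)).exists
  set r := min s 1 / (121 * E.K) with hr
  have hr0 : 0 < r := by positivity
  have hrK : E.K * (120 * r) < min s 1 := by
    have h1 : E.K * (121 * r) = min s 1 := by
      rw [hr]
      field_simp
    have h2 : 0 < E.K * r := by positivity
    linarith
  -- Stable parts of the lifts of `z 0, …, z (N - 1)` close to the stable plane. Including all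
  -- residues `j < N` handles iterates that are not multiples of `N`. The choice of `r` makes `P`
  -- sparse: points too close would give a short period or violate the bound `s`.
  set P : Set (ℝ × ℝ) := {p | ∃ j ∈ Finset.range N, ∃ m, E.q m = 0 ∧ |(m + E.D j e).2| ≤ r ∧
    (m + E.D j e).1 = p} with hP
  have hP0 : ∀ p ∈ P, 120 * r ≤ ‖p‖ := by
    rintro _ ⟨j, hj, m, hm, hmr, rfl⟩
    by_contra! h
    have h1 : ‖m + E.D j e‖ ≤ 120 * r := max_le h.le (by rw [Real.norm_eq_abs]; linarith)
    have h2 : z j = E.q (m + E.D j e) := by rw [_root_.map_add, hm, zero_add]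
    have h3 := hs0 j hj
    rw [h2] at h3
    have h4 : E.K * ‖m + E.D j e‖ ≤ E.K * (120 * r) := by gcongr
    have := E.norm_q_le (m + E.D j e)
    linarith [min_le_left s 1]
  have hPs : ∀ p ∈ P, ∀ p' ∈ P, p ≠ p' → 120 * r ≤ ‖p - p'‖ := by
    rintro _ ⟨j, hj, m, hm, hmr, rfl⟩ _ ⟨j', hj', m', hm', hmr', rfl⟩ hne
    by_contra! h
    set v := (m + E.D j e) - (m' + E.D j' e) with hv
    have h1 : ‖v‖ ≤ 120 * r := by
      refine max_le h.le ?_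
      have := norm_sub_le (m + E.D j e).2 (m' + E.D j' e).2
      rw [Real.norm_eq_abs, Real.norm_eq_abs (m + E.D j e).2,
        Real.norm_eq_abs (m' + E.D j' e).2] at this
      change |(m + E.D j e).2 - (m' + E.D j' e).2| ≤ _
      linarith
    have h4 : E.K * ‖v‖ ≤ E.K * (120 * r) := by gcongr
    have h5 : E.q v = z j - z j' := by
      rw [hv, map_sub, _root_.map_add, _root_.map_add, hm, hm', zero_add, zero_add]
    by_cases hjj : j = j'
    · subst hjj
      rw [sub_self] at h5
      have h6 := E.eq_zero_of_q_eq_zero h5 (by linarith [min_le_right s 1])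
      exact hne (by rw [sub_eq_zero.1 h6])
    · have h6 := hsi j hj j' hj' hjj
      rw [← h5] at h6
      have := E.norm_q_le v
      linarith [min_le_left s 1]
  obtain ⟨φ, hφc, hφ0, hφ⟩ := exists_avoiding_graph hr0 hP0 hPs (pow_pos E.a_pos N)
    (α := E.a ^ N) (β := E.b ^ N) (by
      rw [div_pow, div_lt_iff₀ (pow_pos E.b_pos N)] at hNab
      linarith) (by linarith)
  obtain ⟨τ, hτ, hτs⟩ : ∃ τ > 0, ∀ x ∈ Icc 0 τ,
      E.K * ‖(((x, φ x), 0) : StableUnstable)‖ < s / 2 := by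
    have hc : Continuous fun x : ℝ => E.K * ‖(((x, φ x), 0) : StableUnstable)‖ := by fun_prop
    have h0 : E.K * ‖(((0, φ 0), 0) : StableUnstable)‖ < s / 2 := by
      rw [hφ0]
      change E.K * ‖(0 : StableUnstable)‖ < s / 2
      rw [norm_zero, mul_zero]
      positivity
    obtain ⟨δ, hδ, h⟩ := Metric.eventually_nhds_iff.1
      (hc.continuousAt.eventually_lt_const h0)
    refine ⟨δ / 2, by positivity, fun x hx => h ?_⟩
    rw [Real.dist_eq, sub_zero, abs_of_nonneg hx.1]
    linarith [hx.2]
  have hcN := pow_pos E.c_pos N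
  refine ⟨φ, z 0, hφc, hφ0, τ, hτ, min (s / 2) (r / (E.c ^ N * E.K)), by positivity,
    fun n x hx => ?_⟩
  set w : StableUnstable := ((x, φ x), 0) with hw
  by_contra! hcon
  rw [E.zpow_q] at hcon
  obtain ⟨k', rfl | rfl⟩ := n.eq_nat_or_neg
  · have h1 : ‖E.D k' w‖ ≤ ‖w‖ := by
      refine max_le ((norm_D_fst_le E k' w).trans
        (mul_le_of_le_one_left (norm_nonneg _) (pow_le_one₀ E.b_pos.le E.b_lt_one.le))) ?_
      simp [hw]
    have h2 : E.K * ‖E.D k' w‖ ≤ E.K * ‖w‖ := by gcongr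
    have h3 := E.norm_q_le (E.D k' w)
    have h4 := hs0 0 (Finset.mem_range.2 hN)
    have h5 := hτs x hx
    have h6 := norm_le_norm_add_norm_sub (E.q (E.D k' w)) (z 0)
    rw [← dist_eq_norm] at h6
    linarith [hcon.trans_le (min_le_left _ _)]
  -- If `D (-k') w` were close to `e` modulo periods, applying `D j` would bring `D (-(N * k)) w`
  -- close to a lift of `z j`. This enlarges the error at most by `c ^ N`, which explains the radius
  -- `r / (c ^ N * K)`.
  · set j := k' % N
    set k := k' / N
    have hj : j < N := Nat.mod_lt _ hN
    have hkj : N * k + j = k' := Nat.div_add_mod k' N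
    obtain ⟨u, hu, hue⟩ := E.exists_lift_near (E.D (0 : ℕ) e) (E.q (E.D (-(k' : ℤ)) w))
    have hze : E.D (0 : ℕ) e = e := by simpa using E.D_zero e
    rw [hze] at hue
    have hue' : E.c ^ N * ‖u - e‖ < r := by
      have h1 := hcon.trans_le (min_le_right _ _)
      rw [lt_div_iff₀ (by positivity)] at h1
      have h2 : E.c ^ N * ‖u - e‖ ≤ E.c ^ N * (E.K * dist (E.q (E.D (-(k' : ℤ)) w)) (E.q e)) := by
        gcongr
      have h3 : z 0 = E.q e := by rw [hz]; simp only [hze]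
      rw [h3] at h1
      linarith
    set m := E.D j (E.D (-(k' : ℤ)) w - u) with hm
    have hm0 : E.q m = 0 := E.q_D_eq_zero (by rw [map_sub, hu, sub_self]) _
    have hDk : E.D j (E.D (-(k' : ℤ)) w) = E.D (-((N * k : ℕ) : ℤ)) w := by
      rw [← E.D_add]
      congr 2
      rw [← hkj]
      push_cast
      ring
    have hme : m + E.D j e = E.D (-((N * k : ℕ) : ℤ)) w - E.D j (u - e) := by
      rw [hm, map_sub, map_sub, hDk]
      abel
    have hcj : E.c ^ j ≤ E.c ^ N := pow_le_pow_right₀ E.one_lt_c.le hj.le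
    have hcj0 := pow_pos E.c_pos j
    have h2 : |(m + E.D j e).2| ≤ r := by
      rw [hme]
      simp only [Prod.snd_sub, D_snd, hw, mul_zero, zero_sub, abs_neg, abs_mul, zpow_natCast,
        abs_of_pos hcj0]
      have h3 : |u.2 - e.2| ≤ ‖u - e‖ := norm_snd_le (u - e)
      refine le_trans ?_ hue'.le
      gcongr
    have hmem : (m + E.D j e).1 ∈ P := ⟨j, Finset.mem_range.2 hj, m, hm0, h2, rfl⟩
    have h3 : ‖(E.D j (u - e)).1‖ < r := by
      refine lt_of_le_of_lt ((norm_D_fst_le E j _).trans ?_) hue'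
      gcongr
      exact (pow_le_one₀ E.b_pos.le E.b_lt_one.le).trans (one_le_pow₀ E.one_lt_c.le)
    have h4 : (E.D (-((N * k : ℕ) : ℤ)) w).1 = (((E.a ^ N) ^ k)⁻¹ * x, ((E.b ^ N) ^ k)⁻¹ * φ x) := by
      refine Prod.ext ?_ ?_
      · rw [D_fst_fst, zpow_neg, zpow_natCast, pow_mul]
      · rw [D_fst_snd, zpow_neg, zpow_natCast, pow_mul]
    have h5 : (((E.a ^ N) ^ k)⁻¹ * x, ((E.b ^ N) ^ k)⁻¹ * φ x) - (m + E.D j e).1 =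
        (E.D j (u - e)).1 := by
      rw [← h4, hme]
      simp
    have h6 : |((E.a ^ N) ^ k)⁻¹ * x - (m + E.D j e).1.1| < r := by
      have := norm_fst_le (E.D j (u - e)).1
      rw [← h5] at this h3
      exact this.trans_lt h3
    have h7 : |((E.b ^ N) ^ k)⁻¹ * φ x - (m + E.D j e).1.2| < r := by
      have := norm_snd_le (E.D j (u - e)).1
      rw [← h5] at this h3
      exact this.trans_lt h3
    exact absurd (hφ k x _ hmem h6) (not_le.2 h7)

end DiagonalCover

/-! ### Orbit closures. -/

theorem image_orbitClosure {X : Type*} [MetricSpace X] (f : X ≃ₜ X) (S : Set X) :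
    f '' orbitClosure f S = orbitClosure f S := by
  rw [orbitClosure, f.image_closure, image_iUnion]
  congr 1
  have h : ∀ n : ℤ, f '' ((f ^ n) '' S) = (f ^ (n + 1)) '' S := by
    intro n
    rw [image_image]
    exact image_congr fun x _ => (homeomorph_zpow_add_one_apply f n x).symm
  simp only [h]
  exact (Equiv.addRight (1 : ℤ)).surjective.iUnion_comp fun n : ℤ => (f ^ n) '' S

/-- All iterates of `S` share the fixed point `x₀`. -/
theorem isConnected_orbitClosure {X : Type*} [MetricSpace X] (f : X ≃ₜ X) {S : Set X}
    (hS : IsPreconnected S) {x₀ : X} (hx₀ : x₀ ∈ S) (hfix : f x₀ = x₀) :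
    IsConnected (orbitClosure f S) := by
  have hmem : ∀ n : ℤ, x₀ ∈ (f ^ n) '' S := fun n =>
    ⟨x₀, hx₀, (zpow_mem_iff (s := {x₀}) (by simp [hfix]) n x₀).2 rfl⟩
  refine IsConnected.closure ⟨⟨x₀, mem_iUnion.2 ⟨0, hmem 0⟩⟩, ?_⟩
  exact isPreconnected_iUnion ⟨x₀, mem_iInter.2 hmem⟩
    fun n => hS.image _ (f ^ n).continuous.continuousOn

/-! ### The covering of a toral automorphism -/

theorem toralAut_torusProj (A : GL (Fin 3) ℤ) (v : E3) :
    toralAut A (torusProj v) = torusProj (WithLp.toLp 2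
      (((A : Matrix (Fin 3) (Fin 3) ℤ).map (Int.cast : ℤ → ℝ)).mulVec v)) := by
  funext i
  change ∑ j, (A : Matrix (Fin 3) (Fin 3) ℤ) i j • ((v j : ℝ) : UnitAddCircle) =
    ((∑ j, ((A : Matrix (Fin 3) (Fin 3) ℤ) i j : ℝ) * v j : ℝ) : UnitAddCircle)
  simp [Fin.sum_univ_three, ← zsmul_eq_mul]

theorem toralAut_add (A : GL (Fin 3) ℤ) (x y : T3) :
    toralAut A (x + y) = toralAut A x + toralAut A y := by
  funext i
  change ∑ j, (A : Matrix (Fin 3) (Fin 3) ℤ) i j • (x j + y j) =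
    ∑ j, (A : Matrix (Fin 3) (Fin 3) ℤ) i j • x j + ∑ j, (A : Matrix (Fin 3) (Fin 3) ℤ) i j • y j
  simp only [smul_add, Finset.sum_add_distrib]

/-- The linear coordinates given by an invertible matrix. -/
noncomputable def matrixCoordinates (P : Matrix (Fin 3) (Fin 3) ℝ) (hP : P.det ≠ 0) :
    E3 ≃L[ℝ] StableUnstable :=
  LinearEquiv.toContinuousLinearEquiv
    { toFun := fun v => ((P.mulVec v 0, P.mulVec v 1), P.mulVec v 2)
      map_add' := by intro v w; simp [Matrix.mulVec_add]
      map_smul' := by intro r v; simp [Matrix.mulVec_smul]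
      invFun := fun w => WithLp.toLp 2 (P⁻¹.mulVec ![w.1.1, w.1.2, w.2])
      left_inv := by
        intro v
        have h : ![P.mulVec v 0, P.mulVec v 1, P.mulVec v 2] = P.mulVec v := by
          ext i
          fin_cases i <;> rfl
        simp only [h, Matrix.mulVec_mulVec, Matrix.nonsing_inv_mul _ (isUnit_iff_ne_zero.2 hP),
          Matrix.one_mulVec]
      right_inv := by
        intro w
        simp only [Matrix.mulVec_mulVec, Matrix.mul_nonsing_inv _ (isUnit_iff_ne_zero.2 hP),
          Matrix.one_mulVec]
        rfl }

theorem matrixCoordinates_apply (P : Matrix (Fin 3) (Fin 3) ℝ) (hP : P.det ≠ 0) (v : E3) :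
    matrixCoordinates P hP v = ((P.mulVec v 0, P.mulVec v 1), P.mulVec v 2) := rfl

theorem nonempty_diagonalCover (A : GL (Fin 3) ℤ)
    (hhyp : IsHyperbolicMatrix A)
    (hreal : ∀ z : ℂ, IsEigenvalue A z → ∃ r : ℝ, z = (r : ℂ) ∧ 0 < r ∧ Irrational r)
    (hsimple : HasSimpleEigenvalues A)
    (hone : ∃! r : ℝ, IsEigenvalue A (r : ℂ) ∧ 1 < r) :
    Nonempty (DiagonalCover (toralAut A)) := by
  obtain ⟨l, P, h0, h01, h1, h2, hP, hPA, hm⟩ :=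
    exists_eigencoordinates A hhyp hreal hsimple hone
  set J := matrixCoordinates P hP
  refine ⟨{ a := l 0, b := l 1, c := l 2, J := J, a_pos := h0, a_lt_b := h01, b_lt_one := h1,
            one_lt_c := h2, map_add := toralAut_add A, semiconj := ?_, coord_ne_zero := ?_,
            exists_period := ?_ }⟩
  · intro w
    obtain ⟨v, rfl⟩ := J.surjective w
    rw [J.symm_apply_apply, toralAut_torusProj]
    congr 1
    rw [J.eq_symm_apply, matrixCoordinates_apply, matrixCoordinates_apply]
    have h : ∀ i, P.mulVec (((A : Matrix (Fin 3) (Fin 3) ℤ).map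
        (Int.cast : ℤ → ℝ)).mulVec v) i = l i * P.mulVec v i := by
      intro i
      rw [Matrix.mulVec_mulVec, hPA, ← Matrix.mulVec_mulVec, Matrix.mulVec_diagonal]
    simp only [diagIter, zpow_one, h]
  · intro w hw hq
    obtain ⟨v, rfl⟩ := J.surjective w
    rw [J.symm_apply_apply, torusProj_eq_zero_iff] at hq
    choose m hmv using hq
    have hv : (v : Fin 3 → ℝ) = fun j => (m j : ℝ) := funext fun j => (hmv j).symm
    have hm0 : m ≠ 0 := by
      rintro rfl
      apply hw
      have : v = 0 := by
        ext j
        rw [← hmv j]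
        simp
      rw [this, map_zero]
    rw [matrixCoordinates_apply, hv]
    exact ⟨hm m hm0 0, hm m hm0 1, hm m hm0 2⟩
  · refine ⟨J (EuclideanSpace.single 0 1), ?_, ?_⟩
    · simp
    · rw [J.symm_apply_apply, torusProj_eq_zero_iff]
      intro i
      by_cases hi : i = 0
      · exact ⟨1, by simp [hi]⟩
      · exact ⟨0, by simp [hi]⟩

/-! ### The main theorem. -/

theorem theoremA (A : GL (Fin 3) ℤ)
    (hhyp : IsHyperbolicMatrix A)
    (hreal : ∀ z : ℂ, IsEigenvalue A z → ∃ r : ℝ, z = (r : ℂ) ∧ 0 < r ∧ Irrational r)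
    (hsimple : HasSimpleEigenvalues A)
    (hone : ∃! r : ℝ, IsEigenvalue A (r : ℂ) ∧ 1 < r) :
    (∀ Λ Δ : Set T3, IsCompact Λ → IsConnected Λ → toralAut A '' Λ = Λ → Λ.Nontrivial →
      (∃ x₀ ∈ Λ, toralAut A x₀ = x₀) → Λ ⊆ Δ → IsCompact Δ → toralAut A '' Δ = Δ →
      HasLocalProductStructure (toralAut A) Δ → Δ = univ) ∧
    ∃ (γ : C(unitInterval, T3)) (Λ : Set T3),
      Λ = orbitClosure (toralAut A) (range γ) ∧
      (∃ x₀ ∈ range γ, toralAut A x₀ = x₀) ∧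
      IsCompact Λ ∧ IsConnected Λ ∧ Λ.Nontrivial ∧ toralAut A '' Λ = Λ ∧ Λ ≠ univ ∧
      IsHyperbolicSet (toralAut A) Λ ∧
      (∀ Δ : Set T3, IsCompact Δ → toralAut A '' Δ = Δ → Λ ⊆ Δ →
        (HasLocalProductStructure (toralAut A) Δ ↔ Δ = univ)) ∧
      (∀ Δ : Set T3, IsHyperbolicSet (toralAut A) Δ → Λ ⊆ Δ →
        (IsLocallyMaximal (toralAut A) Δ ↔ Δ = univ)) ∧
      ¬ IsLocallyPremaximal (toralAut A) Λ ∧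
      (∃ V : Set T3, IsOpen V ∧ Λ ⊆ V ∧
        ¬ ∃ Δ : Set T3, IsHyperbolicSet (toralAut A) Δ ∧ IsLocallyMaximal (toralAut A) Δ ∧
          Λ ⊆ Δ ∧ Δ ⊆ V) := by
  obtain ⟨E⟩ := nonempty_diagonalCover A hhyp hreal hsimple hone
  have hpartA : ∀ Λ Δ : Set T3, IsCompact Λ → IsConnected Λ → toralAut A '' Λ = Λ →
      Λ.Nontrivial → (∃ x₀ ∈ Λ, toralAut A x₀ = x₀) → Λ ⊆ Δ → IsCompact Δ →
      toralAut A '' Δ = Δ → HasLocalProductStructure (toralAut A) Δ → Δ = univ := by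
    rintro Λ Δ hc hconn hΛ hnt ⟨x₀, hx₀, hfix⟩ hΛΔ hΔc hΔ hlps
    exact E.eq_univ_of_hasLocalProductStructure hc.isClosed hconn.isPreconnected hΛ hnt hx₀ hfix
      hΛΔ hΔc.isClosed hΔ hlps
  refine ⟨hpartA, ?_⟩
  obtain ⟨φ, p, hφc, hφ0, τ, hτ, κ, hκ, hav⟩ := E.exists_curve_avoiding_ball
  set γ : C(unitInterval, T3) :=
    ⟨fun t => E.q ((τ * t, φ (τ * t)), 0), E.continuous_q.comp (by fun_prop)⟩ with hγ
  have hγ0 : γ 0 = 0 := by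
    have : (((τ * ((0 : unitInterval) : ℝ), φ (τ * ((0 : unitInterval) : ℝ))), 0) :
        StableUnstable) = 0 := by
      simp [hφ0]
    change E.q _ = 0
    rw [this, map_zero]
  have hfix : toralAut A 0 = 0 := by
    have := toralAut_add A 0 0
    simpa using this
  set Λ := orbitClosure (toralAut A) (range γ) with hΛdef
  have hcomp : IsCompact Λ := isClosed_closure.isCompact
  have hsub : range γ ⊆ Λ := by
    intro x hx
    exact subset_closure (mem_iUnion.2 ⟨0, x, hx, by simp⟩)
  have hconn : IsConnected Λ :=
    isConnected_orbitClosure _ (isPreconnected_range γ.continuous) ⟨0, hγ0⟩ hfix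
  have hinv : toralAut A '' Λ = Λ := image_orbitClosure _ _
  have hnt : Λ.Nontrivial := by
    refine ⟨γ 0, hsub ⟨0, rfl⟩, γ 1, hsub ⟨1, rfl⟩, ?_⟩
    rw [hγ0]
    intro h
    -- If both ends of the curve agreed on the torus, a nonzero vector of the stable plane would be
    -- a period.
    refine (E.coord_ne_zero ((τ * ((1 : unitInterval) : ℝ), φ (τ * ((1 : unitInterval) : ℝ))), 0)
      ?_ h.symm).2.2 rfl
    intro h0
    have := congrArg (fun w : StableUnstable => w.1.1) h0
    simp [hτ.ne'] at this
  have hpΛ : p ∉ Λ := by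
    intro hp
    obtain ⟨x, hx, hxp⟩ := Metric.mem_closure_iff.1 hp κ hκ
    obtain ⟨n, hn⟩ := mem_iUnion.1 hx
    obtain ⟨_, ⟨t, rfl⟩, rfl⟩ := hn
    have := hav n (τ * t) ⟨mul_nonneg hτ.le t.2.1, mul_le_of_le_one_right hτ.le t.2.2⟩
    rw [dist_comm] at hxp
    exact absurd hxp (not_lt.2 this)
  have hne : Λ ≠ univ := fun h => hpΛ (h ▸ mem_univ p)
  have hlps : ∀ Δ : Set T3, IsCompact Δ → toralAut A '' Δ = Δ → Λ ⊆ Δ →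
      (HasLocalProductStructure (toralAut A) Δ ↔ Δ = univ) := by
    intro Δ hΔc hΔ hΛΔ
    refine ⟨hpartA Λ Δ hcomp hconn hinv hnt ⟨0, hsub ⟨0, hγ0⟩, hfix⟩ hΛΔ hΔc hΔ, ?_⟩
    rintro rfl
    exact E.hasLocalProductStructure_univ
  have hmax : ∀ Δ : Set T3, IsHyperbolicSet (toralAut A) Δ → Λ ⊆ Δ →
      (IsLocallyMaximal (toralAut A) Δ ↔ Δ = univ) := by
    intro Δ hΔ hΛΔ
    constructor
    · intro h
      exact (hlps Δ hΔ.1 hΔ.2.1 hΛΔ).1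
        (E.hasLocalProductStructure_of_isLocallyMaximal hΔ.1 hΔ.2.1 h)
    · rintro rfl
      exact isLocallyMaximal_univ _
  -- The complement of the avoided point is an open neighbourhood of `Λ` that witnesses both of the
  -- last two claims.
  have hΛp : Λ ⊆ {p}ᶜ := fun x hx hxp => hpΛ (hxp ▸ hx)
  refine ⟨γ, Λ, rfl, ⟨0, ⟨0, hγ0⟩, hfix⟩, hcomp, hconn, hnt, hinv, hne,
    E.isHyperbolicSet hcomp hinv, hlps, hmax, ?_, {p}ᶜ, isOpen_compl_singleton, hΛp, ?_⟩
  · intro h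
    obtain ⟨Δ, hΔ, hΔlps, hΛΔ, hΔU⟩ := h {p}ᶜ isOpen_compl_singleton hΛp
    have h1 := (hlps Δ hΔ.1 hΔ.2.1 hΛΔ).1 hΔlps
    exact hΔU (h1 ▸ mem_univ p) rfl
  · rintro ⟨Δ, hΔ, hΔmax, hΛΔ, hΔV⟩
    have h1 := (hmax Δ hΔ hΛΔ).1 hΔmax
    exact hΔV (h1 ▸ mem_univ p) rfl
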